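/- A permuton is a Borel probability measure on $[-1,1]^2$ both of whose marginals are uniform on $[-1,1]$. Equip the set of permutons with the 2-Wasserstein distance $W$ for the Euclidean metric, $W(\mu,\nu)^2=\inf \mathbb{E}\|V-W'\|^2$, the infimum being over all couplings $(V,W')$ with $V\sim\mu$, $W'\sim\nu$. A permuton-valued path is a $W$-continuous map $t\mapsto\mu(t)$ from $[0,1]$ to the permutons, and its energy is $$\mathcal{E}(\mu)=\sup\ \sum_{i=1}^n \frac{W(\mu(t_{i-1}),\mu(t_i))^2}{t_i-t_{i-1}}\in[0,\infty],$$ the supremum being over all finite partitions $0=t_0<t_1<\dots<t_n=1$. Let $\mathbf{id}$ and $\mathbf{rev}$ be the laws of $(X,X)$ and $(X,-X)$ with $X$ uniform on $[-1,1]$. Let $(A_x,A_y)$ have the Archimedean law, with density $\frac{1}{2\pi\sqrt{1-x^2-y^2}}$ on the open unit disk; set $\mathcal{A}(t)=\cos(\pi t)A_x+\sin(\pi t)A_y$, and let the Archimedean path $\mathbf{A}(t)$ be the law of $(\mathcal{A}(0),\mathcal{A}(t))$, $0\le t\le 1$. Theorem. $\mathbf{A}$ is a permuton-valued path from $\mathbf{A}(0)=\mathbf{id}$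 to $\mathbf{A}(1)=\mathbf{rev}$ with $\mathcal{E}(\mathbf{A})=\pi^2/6$. Every permuton-valued path $\mu$ with $\mu(0)=\mathbf{id}$ and $\mu(1)=\mathbf{rev}$ satisfies $\mathcal{E}(\mu)\ge\pi^2/6$, and if $\mathcal{E}(\mu)=\pi^2/6$, then $\mu(t)=\mathbf{A}(t)$ for every $t\in[0,1]$. -/

import Mathlib

open MeasureTheory Filter Topology
open scoped ENNReal unitInterval

namespace PermutonPaths

noncomputable section

/-- The 2-Wasserstein distance between two Borel measures on a metric space: the square root of
the infimum, over all couplings `π` of `μ` and `ν`, of the expected squared distance. -/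
def wasserstein {K : Type*} [MetricSpace K] [MeasurableSpace K] (μ ν : Measure K) : ℝ≥0∞ :=
  (⨅ (π : Measure (K × K)) (_ : π.fst = μ) (_ : π.snd = ν),
    ∫⁻ z, edist z.1 z.2 ^ 2 ∂π) ^ (1 / 2 : ℝ)

/-- The energy of `γ : [0,1] → X` with respect to a distance function `d` on `X`: the supremum,
over all finite partitions `0 = t₀ < t₁ < ⋯ < tₙ = 1`, of `∑ᵢ d(γ(tᵢ₋₁), γ(tᵢ))² / (tᵢ - tᵢ₋₁)`. -/
def energy {X : Type*} (d : X → X → ℝ≥0∞) (γ : I → X) : ℝ≥0∞ :=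
  ⨆ (n : ℕ) (t : Fin (n + 1) → I) (_ : StrictMono t) (_ : t 0 = 0) (_ : t (Fin.last n) = 1),
    ∑ i : Fin n, d (γ (t i.castSucc)) (γ (t i.succ)) ^ 2 /
      ENNReal.ofReal ((t i.succ : ℝ) - (t i.castSucc : ℝ))

/-- The plane with the Euclidean metric. -/
abbrev Plane : Type := EuclideanSpace ℝ (Fin 2)

/-- The square `[-1,1]²`. -/
def square : Set Plane := {p | ∀ i, p i ∈ Set.Icc (-1 : ℝ) 1}

/-- The uniform distribution on `[-1,1]`. -/
def uniform : Measure ℝ := ProbabilityTheory.cond volume (Set.Icc (-1 : ℝ) 1)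

/-- A permuton: a Borel probability measure on the square `[-1,1]²` (regarded as a measure on the
plane carried by the square) both of whose marginals are uniform on `[-1,1]`. -/
structure IsPermuton (μ : Measure Plane) : Prop where
  isProbabilityMeasure : IsProbabilityMeasure μ
  carried : μ squareᶜ = 0
  map_fst : μ.map (fun p => p 0) = uniform
  map_snd : μ.map (fun p => p 1) = uniform

/-- A permuton-valued path: a map from `[0,1]` to permutons that is continuous with respect to the
2-Wasserstein distance. -/
structure IsPermutonPath (μ : I → Measure Plane) : Prop where
  isPermuton : ∀ t, IsPermuton (μ t)
  continuous : ∀ t, Tendsto (fun s => wasserstein (μ s) (μ t)) (𝓝 t) (𝓝 0)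

/-- The identity permuton: the law of `(X, X)` with `X` uniform on `[-1,1]`. -/
def idPermuton : Measure Plane := uniform.map (fun x => !₂[x, x])

/-- The reverse permuton: the law of `(X, -X)` with `X` uniform on `[-1,1]`. -/
def revPermuton : Measure Plane := uniform.map (fun x => !₂[x, -x])

/-- The Archimedean measure: density `1 / (2π √(1 - x² - y²))` on the unit disk. -/
def archimedeanMeasure : Measure Plane :=
  (volume.restrict (Metric.ball (0 : Plane) 1)).withDensity
    (fun p => ENNReal.ofReal (1 / (2 * Real.pi * Real.sqrt (1 - p 0 ^ 2 - p 1 ^ 2))))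

/-- The Archimedean process `cos(πt) A_x + sin(πt) A_y`, realized on the plane equipped with the
Archimedean measure, `(A_x, A_y)` being the coordinate functions. -/
def archimedeanProcess (t : I) (p : Plane) : ℝ :=
  Real.cos (Real.pi * (t : ℝ)) * p 0 + Real.sin (Real.pi * (t : ℝ)) * p 1

/-- The Archimedean path: at time `t`, the joint law of the Archimedean process at times `0`
and `t`. -/
def archimedeanPath (t : I) : Measure Plane :=
  archimedeanMeasure.map (fun p => !₂[archimedeanProcess 0 p, archimedeanProcess t p])

end

end PermutonPaths

namespace PermutonPaths

/-! For a permuton let `S` and `D` be the half-sum and half-difference of the coordinates. Uniform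
marginals force `E S² + E D² = 1/3`, so `(E S², E D²) = (cos² θ, sin² θ) / 3` for an angle `θ` in
`[0, π/2]`, equal to `0` at the identity and to `π/2` at the reverse permuton. The cost of a
coupling is `2 E|S - S'|² + 2 E|D - D'|²`, and Cauchy–Schwarz bounds it below by `4/3 (1 - cos (θ -
θ'))`, which is `2/3 (θ - θ')²` to leading order (`le_wasserstein_sq`). The energy therefore
dominates that of the real path `2/3 ∫ θ'²`, which is at least `2/3 (π/2)² = π²/6`. For the
Archimedean path every projection of the Archimedean law is uniform, and coupling two times through
the same point of the disk gives the matching upper bound.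

In the equality case `θ(t) = πt/2` and `W(μ(s), μ(t))² ≤ π²/6 (t - s)²`, which exceeds the
Cauchy–Schwarz bound by only `O((t - s)⁴)`. This excess controls the `L²` distance between the
normalized vectors `(S / cos θ, D / sin θ)` at times `s` and `t`
(`charFun_normalizedLaw_le_coupling`). Hence the characteristic function of the normalized law moves
by `O((t - s)²)`, has zero derivative in `t`, and is constant on `(0, 1)`. The marginals of `μ(t)`
say that this single law has uniform projections in the directions `±πt/2`; as `t` varies these fill
all directions off the axes, so the law is Archimedean and determines `μ(t)`. Near-optimal couplings
suffice throughout; no optimal one is needed. -/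

/-! ### Wasserstein distance, the plane, and the uniform law. -/

lemma wasserstein_sq {K : Type*} [MetricSpace K] [MeasurableSpace K] (μ ν : Measure K) :
    wasserstein μ ν ^ 2 = ⨅ (π : Measure (K × K)) (_ : π.fst = μ) (_ : π.snd = ν),
      ∫⁻ z, edist z.1 z.2 ^ 2 ∂π := by
  rw [wasserstein, ← ENNReal.rpow_natCast, ← ENNReal.rpow_mul]
  norm_num

/-- The joint law of `(f, g)` is one admissible coupling. -/
lemma wasserstein_map_sq_le {Ω K : Type*} [MeasurableSpace Ω] [MetricSpace K] [MeasurableSpace K]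
    [BorelSpace K] [SecondCountableTopology K] (ρ : Measure Ω) {f g : Ω → K} (hf : Measurable f)
    (hg : Measurable g) :
    wasserstein (ρ.map f) (ρ.map g) ^ 2 ≤ ∫⁻ ω, edist (f ω) (g ω) ^ 2 ∂ρ := by
  rw [wasserstein_sq]
  refine iInf_le_of_le (ρ.map fun ω => (f ω, g ω)) (iInf_le_of_le ?_ (iInf_le_of_le ?_ ?_))
  · rw [Measure.fst_map_prodMk hg]
  · rw [Measure.snd_map_prodMk hf]
  · rw [lintegral_map ((measurable_fst.edist measurable_snd).pow_const 2) (hf.prodMk hg)]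

lemma plane_edist_sq (p q : Plane) :
    edist p q ^ 2 = ENNReal.ofReal ((p 0 - q 0) ^ 2 + (p 1 - q 1) ^ 2) := by
  rw [edist_dist, ← ENNReal.ofReal_pow dist_nonneg, EuclideanSpace.dist_eq,
    Real.sq_sqrt (by positivity)]
  simp [Fin.sum_univ_two, Real.dist_eq, sq_abs]

lemma measurable_vec {Ω : Type*} [MeasurableSpace Ω] {f g : Ω → ℝ} (hf : Measurable f)
    (hg : Measurable g) : Measurable fun ω => (!₂[f ω, g ω] : Plane) := by
  refine (WithLp.measurable_toLp 2 _).comp (measurable_pi_iff.2 fun i => ?_)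
  fin_cases i
  · exact hf
  · exact hg

lemma measurable_coord (i : Fin 2) : Measurable fun p : Plane => p i :=
  (EuclideanSpace.proj (𝕜 := ℝ) i).continuous.measurable

instance : IsProbabilityMeasure uniform :=
  ProbabilityTheory.cond_isProbabilityMeasure_of_finite (by simp) (by simp)

lemma uniform_eq : uniform = (2 : ℝ≥0∞)⁻¹ • volume.restrict (Set.Icc (-1 : ℝ) 1) := by
  rw [uniform, ProbabilityTheory.cond, Real.volume_Icc]
  norm_num

lemma ae_uniform_mem : ∀ᵐ x ∂uniform, x ∈ Set.Icc (-1 : ℝ) 1 := by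
  rw [uniform_eq]
  exact Measure.ae_smul_measure (ae_restrict_mem measurableSet_Icc) _

lemma integral_sq_uniform : ∫ x, x ^ 2 ∂uniform = 1 / 3 := by
  rw [uniform_eq, integral_smul_measure, integral_Icc_eq_integral_Ioc,
    ← intervalIntegral.integral_of_le (by norm_num), integral_pow]
  norm_num

lemma memLp_uniform : MemLp (fun x : ℝ => x) 2 uniform :=
  MemLp.of_bound measurable_id.aestronglyMeasurable 1
    (ae_uniform_mem.mono fun x hx => by rw [Real.norm_eq_abs]; exact abs_le.2 hx)

/-! ### Second moments. -/

section Moments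

variable {Ω : Type*} [MeasurableSpace Ω] {ρ : Measure Ω}

lemma memLp_of_map_uniform {X : Ω → ℝ} (hX : Measurable X) (h : ρ.map X = uniform) :
    MemLp X 2 ρ := by
  have := memLp_uniform
  rw [← h] at this
  exact (memLp_map_measure_iff measurable_id.aestronglyMeasurable hX.aemeasurable).1 this

lemma integral_sq_of_map_uniform {X : Ω → ℝ} (hX : Measurable X) (h : ρ.map X = uniform) :
    ∫ ω, X ω ^ 2 ∂ρ = 1 / 3 := by
  rw [← integral_sq_uniform, ← h, integral_map hX.aemeasurable (by fun_prop)]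

/-- Cauchy–Schwarz for the second-moment form. -/
lemma sq_integral_mul_le {X Y : Ω → ℝ} (hX : MemLp X 2 ρ) (hY : MemLp Y 2 ρ) :
    (∫ ω, X ω * Y ω ∂ρ) ^ 2 ≤ (∫ ω, X ω ^ 2 ∂ρ) * ∫ ω, Y ω ^ 2 ∂ρ := by
  have hXY : Integrable (fun ω => X ω * Y ω) ρ := hX.integrable_mul hY
  -- The quadratic `l ↦ E (l X + Y)²` is nonnegative, so its discriminant is at most zero.
  have hd : discrim (∫ ω, X ω ^ 2 ∂ρ) (2 * ∫ ω, X ω * Y ω ∂ρ) (∫ ω, Y ω ^ 2 ∂ρ) ≤ 0 := by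
    refine discrim_le_zero fun l => ?_
    have h0 : 0 ≤ ∫ ω, (l * X ω + Y ω) ^ 2 ∂ρ := integral_nonneg fun ω => sq_nonneg _
    have he : ∫ ω, (l * X ω + Y ω) ^ 2 ∂ρ =
        ∫ ω, ((l * l) * X ω ^ 2 + (2 * l) * (X ω * Y ω) + Y ω ^ 2) ∂ρ :=
      integral_congr_ae (ae_of_all _ fun ω => by ring)
    have hi : Integrable (fun ω => (l * l) * X ω ^ 2 + (2 * l) * (X ω * Y ω)) ρ :=
      (hX.integrable_sq.const_mul _).add (hXY.const_mul _)
    rw [he, integral_add hi hY.integrable_sq,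
      integral_add (hX.integrable_sq.const_mul _) (hXY.const_mul _), integral_const_mul,
      integral_const_mul] at h0
    linarith
  rw [discrim] at hd
  linarith

lemma integral_sub_sq {X Y : Ω → ℝ} (hX : MemLp X 2 ρ) (hY : MemLp Y 2 ρ) :
    ∫ ω, (X ω - Y ω) ^ 2 ∂ρ =
      ∫ ω, X ω ^ 2 ∂ρ + ∫ ω, Y ω ^ 2 ∂ρ - 2 * ∫ ω, X ω * Y ω ∂ρ := by
  have hXY : Integrable (fun ω => X ω * Y ω) ρ := hX.integrable_mul hY
  have he : ∫ ω, (X ω - Y ω) ^ 2 ∂ρ = ∫ ω, (X ω ^ 2 + Y ω ^ 2 - 2 * (X ω * Y ω)) ∂ρ :=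
    integral_congr_ae (ae_of_all _ fun ω => by ring)
  have hi : Integrable (fun ω => X ω ^ 2 + Y ω ^ 2) ρ := hX.integrable_sq.add hY.integrable_sq
  rw [he, integral_sub hi (hXY.const_mul _),
    integral_add hX.integrable_sq hY.integrable_sq, integral_const_mul]

lemma integral_add_sq {X Y : Ω → ℝ} (hX : MemLp X 2 ρ) (hY : MemLp Y 2 ρ) :
    ∫ ω, (X ω + Y ω) ^ 2 ∂ρ =
      ∫ ω, X ω ^ 2 ∂ρ + ∫ ω, Y ω ^ 2 ∂ρ + 2 * ∫ ω, X ω * Y ω ∂ρ := by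
  have := integral_sub_sq hX hY.neg
  simp only [Pi.neg_apply, sub_neg_eq_add, neg_sq, mul_neg, integral_neg] at this
  exact this

end Moments

/-! ### The angle of a permuton and the Cauchy–Schwarz lower bound for the distance. -/

/-- The half-sum of the coordinates. -/
noncomputable def halfSum (p : Plane) : ℝ := (p 0 + p 1) / 2

/-- The half-difference of the coordinates. -/
noncomputable def halfDiff (p : Plane) : ℝ := (p 1 - p 0) / 2

@[fun_prop]
lemma measurable_halfSum : Measurable halfSum :=
  ((measurable_coord 0).add (measurable_coord 1)).div_const 2

@[fun_prop]
lemma measurable_halfDiff : Measurable halfDiff :=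
  ((measurable_coord 1).sub (measurable_coord 0)).div_const 2

lemma plane_edist_sq_eq (p q : Plane) : edist p q ^ 2 =
    ENNReal.ofReal (2 * (halfSum p - halfSum q) ^ 2 + 2 * (halfDiff p - halfDiff q) ^ 2) := by
  rw [plane_edist_sq, halfSum, halfSum, halfDiff, halfDiff]
  congr 1
  ring

/-- The position, on the quarter circle from the identity to the reverse permuton, recorded by the
covariance of a permuton. -/
noncomputable def angle (μ : Measure Plane) : ℝ := Real.arccos (3 * ∫ p, p 0 * p 1 ∂μ) / 2

lemma angle_nonneg (μ : Measure Plane) : 0 ≤ angle μ :=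
  div_nonneg (Real.arccos_nonneg _) zero_le_two

lemma angle_le (μ : Measure Plane) : angle μ ≤ Real.pi / 2 :=
  div_le_div_of_nonneg_right (Real.arccos_le_pi _) zero_le_two

namespace IsPermuton

variable {μ ν : Measure Plane}

lemma map_coord (hμ : IsPermuton μ) (i : Fin 2) : μ.map (fun p => p i) = uniform := by
  fin_cases i
  exacts [hμ.map_fst, hμ.map_snd]

lemma memLp_coord (hμ : IsPermuton μ) (i : Fin 2) : MemLp (fun p : Plane => p i) 2 μ :=
  memLp_of_map_uniform (measurable_coord i) (hμ.map_coord i)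

lemma integral_coord_sq (hμ : IsPermuton μ) (i : Fin 2) : ∫ p, p i ^ 2 ∂μ = 1 / 3 :=
  integral_sq_of_map_uniform (measurable_coord i) (hμ.map_coord i)

/-- Cauchy–Schwarz puts the correlation `3 E[XY]` in `[-1, 1]`, so `arccos` is not truncating. -/
lemma cos_two_angle (hμ : IsPermuton μ) :
    Real.cos (2 * angle μ) = 3 * ∫ p, p 0 * p 1 ∂μ := by
  have h := sq_integral_mul_le (hμ.memLp_coord 0) (hμ.memLp_coord 1)
  rw [hμ.integral_coord_sq, hμ.integral_coord_sq] at h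
  have h' := abs_le.1 (abs_le_of_sq_le_sq
    (by linarith : (∫ p : Plane, p 0 * p 1 ∂μ) ^ 2 ≤ (1 / 3) ^ 2) (by norm_num))
  rw [angle, mul_div_cancel₀ _ two_ne_zero, Real.cos_arccos (by linarith) (by linarith)]

lemma memLp_halfSum (hμ : IsPermuton μ) : MemLp halfSum 2 μ := by
  have := ((hμ.memLp_coord 0).add (hμ.memLp_coord 1)).const_mul (1 / 2)
  refine this.ae_eq (ae_of_all _ fun p => ?_)
  simp only [halfSum, Pi.add_apply]
  ring

lemma memLp_halfDiff (hμ : IsPermuton μ) : MemLp halfDiff 2 μ := by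
  have := ((hμ.memLp_coord 1).sub (hμ.memLp_coord 0)).const_mul (1 / 2)
  refine this.ae_eq (ae_of_all _ fun p => ?_)
  simp only [halfDiff, Pi.sub_apply]
  ring

lemma integral_halfSum_sq (hμ : IsPermuton μ) :
    ∫ p, halfSum p ^ 2 ∂μ = Real.cos (angle μ) ^ 2 / 3 := by
  have h := integral_add_sq (hμ.memLp_coord 0) (hμ.memLp_coord 1)
  rw [hμ.integral_coord_sq, hμ.integral_coord_sq] at h
  have hc := hμ.cos_two_angle
  rw [Real.cos_two_mul] at hc
  simp only [halfSum, div_pow, integral_div, h]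
  linarith

lemma integral_halfDiff_sq (hμ : IsPermuton μ) :
    ∫ p, halfDiff p ^ 2 ∂μ = Real.sin (angle μ) ^ 2 / 3 := by
  have h := integral_sub_sq (hμ.memLp_coord 1) (hμ.memLp_coord 0)
  rw [hμ.integral_coord_sq, hμ.integral_coord_sq] at h
  have hc := hμ.cos_two_angle
  rw [Real.cos_two_mul, Real.cos_sq'] at hc
  have he : ∫ p : Plane, p 1 * p 0 ∂μ = ∫ p : Plane, p 0 * p 1 ∂μ :=
    integral_congr_ae (ae_of_all _ fun p => mul_comm _ _)
  simp only [halfDiff, div_pow, integral_div, h, he]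
  linarith

section Coupling

variable {π : Measure (Plane × Plane)}

lemma memLp_fst {f : Plane → ℝ} (h₁ : π.fst = μ) (hf : MemLp f 2 μ) :
    MemLp (fun z : Plane × Plane => f z.1) 2 π := by
  rw [← h₁, Measure.fst] at hf
  exact hf.comp_of_map measurable_fst.aemeasurable

lemma memLp_snd {f : Plane → ℝ} (h₂ : π.snd = ν) (hf : MemLp f 2 ν) :
    MemLp (fun z : Plane × Plane => f z.2) 2 π := by
  rw [← h₂, Measure.snd] at hf
  exact hf.comp_of_map measurable_snd.aemeasurable

lemma integral_fst_sq {f : Plane → ℝ} (h₁ : π.fst = μ) (hf : Measurable f) :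
    ∫ z, f z.1 ^ 2 ∂π = ∫ p, f p ^ 2 ∂μ := by
  rw [← h₁, Measure.fst, integral_map measurable_fst.aemeasurable
    (hf.pow_const 2).aestronglyMeasurable]

lemma integral_snd_sq {f : Plane → ℝ} (h₂ : π.snd = ν) (hf : Measurable f) :
    ∫ z, f z.2 ^ 2 ∂π = ∫ p, f p ^ 2 ∂ν := by
  rw [← h₂, Measure.snd, integral_map measurable_snd.aemeasurable
    (hf.pow_const 2).aestronglyMeasurable]

lemma lintegral_edist_sq (hμ : IsPermuton μ) (hν : IsPermuton ν) (h₁ : π.fst = μ)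
    (h₂ : π.snd = ν) : ∫⁻ z, edist z.1 z.2 ^ 2 ∂π =
      ENNReal.ofReal (2 * ∫ z, (halfSum z.1 - halfSum z.2) ^ 2 ∂π +
        2 * ∫ z, (halfDiff z.1 - halfDiff z.2) ^ 2 ∂π) := by
  have hS := ((memLp_fst h₁ hμ.memLp_halfSum).sub (memLp_snd h₂ hν.memLp_halfSum)).integrable_sq
  have hD := ((memLp_fst h₁ hμ.memLp_halfDiff).sub (memLp_snd h₂ hν.memLp_halfDiff)).integrable_sq
  simp only [Pi.sub_apply] at hS hD
  have hi : Integrable (fun z : Plane × Plane => 2 * (halfSum z.1 - halfSum z.2) ^ 2 +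
      2 * (halfDiff z.1 - halfDiff z.2) ^ 2) π := (hS.const_mul 2).add (hD.const_mul 2)
  simp only [plane_edist_sq_eq]
  rw [← integral_const_mul, ← integral_const_mul,
    ← integral_add (hS.const_mul 2) (hD.const_mul 2),
    ofReal_integral_eq_lintegral_ofReal hi
      (ae_of_all _ fun z => by simp only [Pi.zero_apply]; positivity)]

/-- After expanding the squares only the cross terms depend on the coupling. Cauchy–Schwarz bounds
them by `cos θ cos θ' / 3` and `sin θ sin θ' / 3`, which add up to `cos (θ - θ') / 3`. -/
lemma le_coupling_cost (hμ : IsPermuton μ) (hν : IsPermuton ν) (h₁ : π.fst = μ)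
    (h₂ : π.snd = ν) : 4 / 3 * (1 - Real.cos (angle μ - angle ν)) ≤
      2 * ∫ z, (halfSum z.1 - halfSum z.2) ^ 2 ∂π +
        2 * ∫ z, (halfDiff z.1 - halfDiff z.2) ^ 2 ∂π := by
  have key : ∀ {m a b : ℝ}, m ^ 2 ≤ a ^ 2 / 3 * (b ^ 2 / 3) → 0 ≤ a → 0 ≤ b → m ≤ a * b / 3 :=
    fun h ha hb => (abs_le.1 (abs_le_of_sq_le_sq (by linarith) (by positivity))).2
  have hP := sq_integral_mul_le (memLp_fst h₁ hμ.memLp_halfSum) (memLp_snd h₂ hν.memLp_halfSum)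
  have hQ := sq_integral_mul_le (memLp_fst h₁ hμ.memLp_halfDiff) (memLp_snd h₂ hν.memLp_halfDiff)
  rw [integral_sub_sq (memLp_fst h₁ hμ.memLp_halfSum) (memLp_snd h₂ hν.memLp_halfSum),
    integral_sub_sq (memLp_fst h₁ hμ.memLp_halfDiff) (memLp_snd h₂ hν.memLp_halfDiff)]
  rw [integral_fst_sq h₁ measurable_halfSum, integral_snd_sq h₂ measurable_halfSum,
    hμ.integral_halfSum_sq, hν.integral_halfSum_sq] at hP ⊢
  rw [integral_fst_sq h₁ measurable_halfDiff, integral_snd_sq h₂ measurable_halfDiff,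
    hμ.integral_halfDiff_sq, hν.integral_halfDiff_sq] at hQ ⊢
  -- Both angles lie in the first quadrant, so the square roots of the second moments carry no sign
  -- ambiguity.
  have hcos : ∀ μ, 0 ≤ Real.cos (angle μ) := fun μ => Real.cos_nonneg_of_neg_pi_div_two_le_of_le
    (by linarith [angle_nonneg μ, Real.pi_pos]) (angle_le μ)
  have hsin : ∀ μ, 0 ≤ Real.sin (angle μ) := fun μ => Real.sin_nonneg_of_nonneg_of_le_pi
    (angle_nonneg μ) (by linarith [angle_le μ, Real.pi_pos])
  have hP' := key hP (hcos μ) (hcos ν)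
  have hQ' := key hQ (hsin μ) (hsin ν)
  rw [Real.cos_sub]
  have e₁ := Real.sin_sq_add_cos_sq (angle μ)
  have e₂ := Real.sin_sq_add_cos_sq (angle ν)
  linarith

end Coupling

lemma le_wasserstein_sq (hμ : IsPermuton μ) (hν : IsPermuton ν) :
    ENNReal.ofReal (4 / 3 * (1 - Real.cos (angle μ - angle ν))) ≤ wasserstein μ ν ^ 2 := by
  rw [wasserstein_sq]
  refine le_iInf fun π => le_iInf fun h₁ => le_iInf fun h₂ => ?_
  rw [lintegral_edist_sq hμ hν h₁ h₂]
  exact ENNReal.ofReal_le_ofReal (le_coupling_cost hμ hν h₁ h₂)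

end IsPermuton

/-! ### Lower bounds for the energy in terms of the angle. -/

lemma sum_le_energy {X : Type*} (d : X → X → ℝ≥0∞) (γ : I → X) {N : ℕ} {f : ℕ → I}
    (hf : ∀ i < N, f i < f (i + 1)) (h0 : f 0 = 0) (hN : f N = 1) :
    ∑ i ∈ Finset.range N, d (γ (f i)) (γ (f (i + 1))) ^ 2 /
      ENNReal.ofReal ((f (i + 1) : ℝ) - (f i : ℝ)) ≤ energy d γ := by
  have hmono : StrictMono fun i : Fin (N + 1) => f i :=
    Fin.strictMono_iff_lt_succ.2 fun i => by simpa using hf i i.2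
  refine le_trans (le_of_eq ?_) (le_iSup_of_le N (le_iSup_of_le (fun i : Fin (N + 1) => f i)
    (le_iSup_of_le hmono (le_iSup_of_le (by simpa using h0) (le_iSup_of_le (by simpa using hN)
      le_rfl)))))
  rw [← Fin.sum_univ_eq_sum_range]
  simp

/-- Jensen's inequality: the increments lie in `[-π/2, π/2]`, where `cos` is concave, and they
telescope. -/
lemma card_mul_one_sub_cos_le {n : ℕ} (hn : 0 < n) {x : ℕ → ℝ}
    (hx : ∀ i, x i ∈ Set.Icc 0 (Real.pi / 2)) :
    n * (1 - Real.cos ((x n - x 0) / n)) ≤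
      ∑ i ∈ Finset.range n, (1 - Real.cos (x (i + 1) - x i)) := by
  have hn' : (0 : ℝ) < n := by exact_mod_cast hn
  have h := strictConcaveOn_cos_Icc.concaveOn.le_map_sum (t := Finset.range n)
    (w := fun _ => (n : ℝ)⁻¹) (p := fun i => x (i + 1) - x i) (fun _ _ => by positivity)
    (by simp [hn'.ne'])
    (fun i _ => ⟨by linarith [(hx (i + 1)).1, (hx i).2], by linarith [(hx (i + 1)).2, (hx i).1]⟩)
  simp only [smul_eq_mul, ← Finset.mul_sum, Finset.sum_range_sub] at h
  rw [Finset.sum_sub_distrib, Finset.sum_const, Finset.card_range, nsmul_eq_mul, mul_one,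
    div_eq_inv_mul]
  have := mul_le_mul_of_nonneg_left h hn'.le
  rw [mul_inv_cancel_left₀ hn'.ne'] at this
  linarith

/-- As `n → ∞` the left side tends to `2/3 (Δθ)² / l`, the least energy of an angular displacement
`Δθ` over a time `l`. -/
lemma block_le_sum {μ : I → Measure Plane} (hμ : ∀ t, IsPermuton (μ t)) {n : ℕ} (hn : 0 < n)
    {f : ℕ → I} {l : ℝ} (hl : 0 < l) (hf : ∀ i < n, (f (i + 1) : ℝ) - f i = l / n) :
    ENNReal.ofReal (4 / 3 * (n ^ 2 * (1 - Real.cos ((angle (μ (f n)) - angle (μ (f 0))) / n))) / l) ≤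
      ∑ i ∈ Finset.range n, wasserstein (μ (f i)) (μ (f (i + 1))) ^ 2 /
        ENNReal.ofReal ((f (i + 1) : ℝ) - (f i : ℝ)) := by
  have hn' : (0 : ℝ) < n := by exact_mod_cast hn
  have hb := card_mul_one_sub_cos_le hn (x := fun i => angle (μ (f i)))
    fun i => ⟨angle_nonneg _, angle_le _⟩
  calc _ ≤ ENNReal.ofReal (∑ i ∈ Finset.range n,
        4 / 3 * (1 - Real.cos (angle (μ (f (i + 1))) - angle (μ (f i)))) / (l / n)) := by
        refine ENNReal.ofReal_le_ofReal ?_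
        rw [← Finset.sum_div, ← Finset.mul_sum]
        have e : 4 / 3 * (n ^ 2 * (1 - Real.cos ((angle (μ (f n)) - angle (μ (f 0))) / n))) / l =
            4 / 3 * (n * (1 - Real.cos ((angle (μ (f n)) - angle (μ (f 0))) / n))) / (l / n) := by
          field_simp
        rw [e]
        gcongr
    _ = ∑ i ∈ Finset.range n, ENNReal.ofReal
        (4 / 3 * (1 - Real.cos (angle (μ (f (i + 1))) - angle (μ (f i)))) / (l / n)) := by
        refine ENNReal.ofReal_sum_of_nonneg fun i _ => ?_
        have := Real.cos_le_one (angle (μ (f (i + 1))) - angle (μ (f i)))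
        exact div_nonneg (by linarith) (by positivity)
    _ ≤ _ := by
        refine Finset.sum_le_sum fun i hi => ?_
        rw [hf i (Finset.mem_range.1 hi), ENNReal.ofReal_div_of_pos (by positivity)]
        gcongr
        rw [← neg_sub (angle (μ (f i))), Real.cos_neg]
        exact (hμ _).le_wasserstein_sq (hμ _)

lemma tendsto_sq_mul_one_sub_cos (x : ℝ) :
    Tendsto (fun n : ℕ => (n : ℝ) ^ 2 * (1 - Real.cos (x / n))) atTop (𝓝 (x ^ 2 / 2)) := by
  have hz : Tendsto (fun n : ℕ => x / n) atTop (𝓝 0) := tendsto_const_div_atTop_nhds_zero_nat x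
  have hs : Tendsto (fun n : ℕ => x ^ 2 / 2 * (Real.sinc (x / n / 2)) ^ 2) atTop
      (𝓝 (x ^ 2 / 2)) := by
    have h1 : Tendsto (fun n : ℕ => Real.sinc (x / n / 2)) atTop (𝓝 1) := by
      have := (Real.continuous_sinc.tendsto 0).comp (by simpa using hz.div_const 2)
      rw [Real.sinc_zero] at this
      exact this
    simpa using (h1.pow 2).const_mul (x ^ 2 / 2)
  -- The half-angle formula gives `n² (1 - cos (x/n)) = (x²/2) sinc² (x/(2n))`.
  refine hs.congr' ?_
  filter_upwards [eventually_gt_atTop 0] with n hn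
  have hn' : (n : ℝ) ≠ 0 := by positivity
  rcases eq_or_ne x 0 with rfl | hx
  · simp
  rw [Real.sinc_of_ne_zero (by positivity)]
  have hc : Real.cos (x / n) = 1 - 2 * Real.sin (x / n / 2) ^ 2 := by
    conv_lhs => rw [← mul_div_cancel₀ (x / n) (two_ne_zero (α := ℝ))]
    rw [Real.cos_two_mul, Real.cos_sq']
    ring
  rw [hc]
  field_simp
  ring

/-- The energy of a path of permutons controls the angular displacement before `s` and after `t`
together with the Wasserstein displacement between `s` and `t`. -/
lemma three_block_le_energy {μ : I → Measure Plane} (hμ : ∀ t, IsPermuton (μ t)) {s t : I}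
    (hs : 0 < s) (hst : s < t) (ht : t < 1) :
    ENNReal.ofReal (2 / 3 * (angle (μ s) - angle (μ 0)) ^ 2 / s +
      2 / 3 * (angle (μ 1) - angle (μ t)) ^ 2 / (1 - t)) +
      wasserstein (μ s) (μ t) ^ 2 / ENNReal.ofReal ((t : ℝ) - s) ≤ energy wasserstein μ := by
  have hs' : (0 : ℝ) < s := hs
  have hst' : (s : ℝ) < t := hst
  have ht' : (t : ℝ) < 1 := ht
  have hlim : Tendsto (fun n : ℕ => ENNReal.ofReal
      (4 / 3 * (n ^ 2 * (1 - Real.cos ((angle (μ s) - angle (μ 0)) / n))) / s +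
        4 / 3 * (n ^ 2 * (1 - Real.cos ((angle (μ 1) - angle (μ t)) / n))) / (1 - t)) +
      wasserstein (μ s) (μ t) ^ 2 / ENNReal.ofReal ((t : ℝ) - s)) atTop
      (𝓝 (ENNReal.ofReal (4 / 3 * ((angle (μ s) - angle (μ 0)) ^ 2 / 2) / s +
        4 / 3 * ((angle (μ 1) - angle (μ t)) ^ 2 / 2) / (1 - t)) +
      wasserstein (μ s) (μ t) ^ 2 / ENNReal.ofReal ((t : ℝ) - s))) :=
    (ENNReal.tendsto_ofReal ((((tendsto_sq_mul_one_sub_cos _).const_mul _).div_const _).add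
      (((tendsto_sq_mul_one_sub_cos _).const_mul _).div_const _))).add tendsto_const_nhds
  have e : ∀ x : ℝ, 4 / 3 * (x ^ 2 / 2) = 2 / 3 * x ^ 2 := fun x => by ring
  rw [e, e] at hlim
  refine le_of_tendsto hlim ?_
  filter_upwards [eventually_gt_atTop 0] with n hn
  have hn' : (0 : ℝ) < n := by exact_mod_cast hn
  -- The partition has `2n + 1` steps: `n` equal ones on `[0, s]`, the single jump from `s` (index
  -- `n`) to `t` (index `n + 1`), then `n` equal ones on `[t, 1]`.
  let g : ℕ → ℝ := fun k =>
    if k ≤ n then s * (k / n) else t + (1 - t) * (((k - (n + 1) : ℕ) : ℝ) / n)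
  let f : ℕ → I := fun k => Set.projIcc 0 1 zero_le_one (g k)
  have hfst : ∀ k ≤ n, (f k : ℝ) = s * (k / n) := by
    intro k hk
    have hk' : (k : ℝ) / n ≤ 1 := div_le_one_of_le₀ (by exact_mod_cast hk) hn'.le
    have : g k = s * (k / n) := if_pos hk
    simp only [f, this]
    rw [Set.projIcc_of_mem zero_le_one ⟨by positivity, by nlinarith⟩]
  have hsnd : ∀ j ≤ n, (f (n + 1 + j) : ℝ) = t + (1 - t) * (j / n) := by
    intro j hj
    have hj' : (j : ℝ) / n ≤ 1 := div_le_one_of_le₀ (by exact_mod_cast hj) hn'.le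
    have hj0 : 0 ≤ (j : ℝ) / n := by positivity
    have : g (n + 1 + j) = t + (1 - t) * (j / n) := by
      simp only [g]
      rw [if_neg (by omega), Nat.add_sub_cancel_left]
    simp only [f, this]
    rw [Set.projIcc_of_mem zero_le_one ⟨by nlinarith, by nlinarith⟩]
  have f0 : f 0 = 0 := Subtype.ext (by rw [hfst 0 hn.le]; simp)
  have fn : f n = s := Subtype.ext (by rw [hfst n le_rfl, div_self hn'.ne', mul_one])
  have fm : f (n + 1) = t := Subtype.ext (by simpa using hsnd 0 hn.le)
  have fN : f (n + 1 + n) = 1 :=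
    Subtype.ext (by rw [hsnd n le_rfl, div_self hn'.ne']; simp)
  have d1 : ∀ i < n, (f (i + 1) : ℝ) - f i = s / n := fun i hi => by
    rw [hfst _ hi, hfst _ hi.le]; push_cast; ring
  have d2 : ∀ i < n, (f (n + 1 + (i + 1)) : ℝ) - f (n + 1 + i) = (1 - t) / n := fun i hi => by
    rw [hsnd _ hi, hsnd _ hi.le]; push_cast; ring
  have hlt : ∀ i < n + 1 + n, f i < f (i + 1) := by
    intro i hi
    rw [← Subtype.coe_lt_coe, ← sub_pos]
    rcases lt_trichotomy i n with h | rfl | h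
    · rw [d1 i h]; positivity
    · rw [fn, fm]; linarith
    · obtain ⟨j, rfl⟩ := Nat.exists_eq_add_of_le (Nat.succ_le_of_lt h)
      have := d2 j (by omega)
      rw [← add_assoc] at this
      simp only [Nat.succ_eq_add_one]
      rw [this]
      exact div_pos (by linarith) hn'
  refine le_trans ?_ (sum_le_energy wasserstein μ hlt f0 fN)
  rw [Finset.sum_range_add, Finset.sum_range_succ]
  have b1 := block_le_sum hμ hn hs' d1
  have b2 := block_le_sum hμ hn (f := fun i => f (n + 1 + i)) (sub_pos.2 ht') d2
  simp only [add_zero, fn, fm, f0, fN] at b1 b2 ⊢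
  rw [ENNReal.ofReal_add, add_right_comm]
  · simp only [← add_assoc] at b2
    gcongr
  · have := Real.cos_le_one ((angle (μ s) - angle (μ 0)) / n)
    have : 0 ≤ 1 - Real.cos ((angle (μ s) - angle (μ 0)) / n) := by linarith
    positivity
  · have := Real.cos_le_one ((angle (μ 1) - angle (μ t)) / n)
    have : 0 ≤ 1 - Real.cos ((angle (μ 1) - angle (μ t)) / n) := by linarith
    exact div_nonneg (by positivity) (by linarith)

/-! ### Endpoint angles and continuity of the angle. -/

lemma measurable_coord_mul : Measurable fun p : Plane => p 0 * p 1 :=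
  (measurable_coord 0).mul (measurable_coord 1)

lemma angle_idPermuton : angle idPermuton = 0 := by
  have hm : Measurable fun x : ℝ => (!₂[x, x] : Plane) := measurable_vec measurable_id measurable_id
  have : ∫ p, p 0 * p 1 ∂idPermuton = 1 / 3 := by
    rw [idPermuton, integral_map hm.aemeasurable measurable_coord_mul.aestronglyMeasurable,
      ← integral_sq_uniform]
    simp [sq]
  rw [angle, this]
  simp

lemma angle_revPermuton : angle revPermuton = Real.pi / 2 := by
  have hm : Measurable fun x : ℝ => (!₂[x, -x] : Plane) :=
    measurable_vec measurable_id measurable_id.neg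
  have : ∫ p, p 0 * p 1 ∂revPermuton = -(1 / 3) := by
    rw [revPermuton, integral_map hm.aemeasurable measurable_coord_mul.aestronglyMeasurable,
      ← integral_sq_uniform,
      ← integral_neg]
    simp [sq]
  rw [angle, this]
  norm_num

/-- The distance lower bound forces `cos` of the angle difference to tend to `1`; since that
difference is at most `π/2` in absolute value, `arccos` recovers it. -/
lemma IsPermutonPath.continuous_angle {μ : I → Measure Plane} (hμ : IsPermutonPath μ) :
    Continuous fun t => angle (μ t) := by
  refine continuous_iff_continuousAt.2 fun t => ?_
  have h1 : Tendsto (fun s => Real.cos (angle (μ s) - angle (μ t))) (𝓝 t) (𝓝 1) := by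
    have hW : Tendsto (fun s => wasserstein (μ s) (μ t) ^ 2) (𝓝 t) (𝓝 0) := by
      simpa using ENNReal.Tendsto.pow (n := 2) (hμ.continuous t)
    have hE := tendsto_of_tendsto_of_tendsto_of_le_of_le tendsto_const_nhds hW (fun _ => zero_le)
      fun s => (hμ.isPermuton s).le_wasserstein_sq (hμ.isPermuton t)
    have hR := (ENNReal.tendsto_toReal ENNReal.zero_ne_top).comp hE
    have : ∀ s, (ENNReal.ofReal (4 / 3 * (1 - Real.cos (angle (μ s) - angle (μ t))))).toReal =
        4 / 3 * (1 - Real.cos (angle (μ s) - angle (μ t))) := fun s =>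
      ENNReal.toReal_ofReal (by linarith [Real.cos_le_one (angle (μ s) - angle (μ t))])
    simp only [Function.comp_def, this, ENNReal.toReal_zero] at hR
    have := (hR.const_mul (3 / 4)).const_sub 1
    simp only [mul_zero, sub_zero] at this
    exact this.congr fun s => by ring
  have h2 : Tendsto (fun s => |angle (μ s) - angle (μ t)|) (𝓝 t) (𝓝 0) := by
    have := (Real.continuous_arccos.tendsto 1).comp h1
    rw [Real.arccos_one] at this
    refine this.congr fun s => ?_
    rw [Function.comp, ← Real.cos_abs, Real.arccos_cos (abs_nonneg _)]
    rw [abs_le]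
    constructor <;> linarith [angle_nonneg (μ s), angle_nonneg (μ t), angle_le (μ s),
      angle_le (μ t), Real.pi_pos]
  exact tendsto_iff_dist_tendsto_zero.2 h2

/-! ### The Archimedean law and the Archimedean path. -/

/-- The density of the Archimedean law, extended by zero to the whole plane. -/
noncomputable def archimedeanDensity (x y : ℝ) : ℝ≥0∞ :=
  {z : ℝ × ℝ | z.1 ^ 2 + z.2 ^ 2 < 1}.indicator
    (fun z => ENNReal.ofReal (1 / (2 * Real.pi * Real.sqrt (1 - z.1 ^ 2 - z.2 ^ 2)))) (x, y)

lemma measurable_archimedeanDensity :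
    Measurable fun z : ℝ × ℝ => archimedeanDensity z.1 z.2 := by
  refine Measurable.indicator (by fun_prop) (measurableSet_lt (by fun_prop) measurable_const)

lemma plane_norm_sq (p : Plane) : ‖p‖ ^ 2 = p 0 ^ 2 + p 1 ^ 2 := by
  rw [EuclideanSpace.norm_sq_eq, Fin.sum_univ_two, Real.norm_eq_abs, Real.norm_eq_abs, sq_abs,
    sq_abs]

lemma archimedeanMeasure_eq :
    archimedeanMeasure = volume.withDensity fun p : Plane => archimedeanDensity (p 0) (p 1) := by
  rw [archimedeanMeasure, ← withDensity_indicator measurableSet_ball]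
  congr 1
  ext p
  have : p ∈ Metric.ball (0 : Plane) 1 ↔ p 0 ^ 2 + p 1 ^ 2 < 1 := by
    rw [mem_ball_zero_iff, ← plane_norm_sq, sq_lt_one_iff₀ (norm_nonneg _)]
  simp only [archimedeanDensity, Set.indicator, this, Set.mem_ofPred_eq]

lemma measurable_archimedeanDensity_coord :
    Measurable fun p : Plane => archimedeanDensity (p 0) (p 1) :=
  measurable_archimedeanDensity.comp ((measurable_coord 0).prodMk (measurable_coord 1))

lemma archimedeanDensity_congr {x y x' y' : ℝ} (h : x ^ 2 + y ^ 2 = x' ^ 2 + y' ^ 2) :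
    archimedeanDensity x y = archimedeanDensity x' y' := by
  simp only [archimedeanDensity, Set.indicator, Set.mem_ofPred_eq, sub_sub, h]

lemma archimedeanMeasure_map_isometry (L : Plane ≃ₗᵢ[ℝ] Plane) :
    archimedeanMeasure.map L = archimedeanMeasure := by
  ext s hs
  have hL : Measurable L := L.continuous.measurable
  rw [Measure.map_apply hL hs, archimedeanMeasure_eq, withDensity_apply _ (hL hs),
    withDensity_apply _ hs,
    ← L.measurePreserving.setLIntegral_comp_preimage hs measurable_archimedeanDensity_coord]
  refine lintegral_congr fun p => archimedeanDensity_congr ?_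
  rw [← plane_norm_sq, ← plane_norm_sq, L.norm_map]

/-- Rotation of the plane by the angle `a`. -/
noncomputable def rotation (a : ℝ) : Plane ≃ₗᵢ[ℝ] Plane :=
  LinearIsometry.toLinearIsometryEquiv
    { toFun := fun p => !₂[Real.cos a * p 0 - Real.sin a * p 1, Real.sin a * p 0 + Real.cos a * p 1]
      map_add' := fun p q => by ext i; fin_cases i <;> simp <;> ring
      map_smul' := fun c p => by ext i; fin_cases i <;> simp <;> ring
      norm_map' := fun p => by
        rw [← sq_eq_sq₀ (norm_nonneg _) (norm_nonneg _), plane_norm_sq, plane_norm_sq]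
        have := Real.sin_sq_add_cos_sq a
        simp
        linear_combination (p 0 ^ 2 + p 1 ^ 2) * this } rfl

lemma rotation_zero (a : ℝ) (p : Plane) :
    rotation a p 0 = Real.cos a * p 0 - Real.sin a * p 1 := rfl

lemma rotation_one (a : ℝ) (p : Plane) :
    rotation a p 1 = Real.sin a * p 0 + Real.cos a * p 1 := rfl

/-- The antiderivative is `arcsin (y / r) / (2π)`. The value does not depend on `r`, which is
Archimedes' hat-box theorem and makes the marginals uniform. -/
lemma lintegral_inv_sqrt {r : ℝ} (hr : 0 < r) :
    ∫⁻ y in Set.Ioo (-r) r, ENNReal.ofReal (1 / (2 * Real.pi * Real.sqrt (r ^ 2 - y ^ 2))) =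
      2⁻¹ := by
  have hcont : ContinuousOn (fun y => (2 * Real.pi)⁻¹ * Real.arcsin (y / r)) (Set.Icc (-r) r) := by
    have := Real.continuous_arcsin
    fun_prop
  have hderiv : ∀ y ∈ Set.Ioo (-r) r, HasDerivAt (fun y => (2 * Real.pi)⁻¹ * Real.arcsin (y / r))
      (1 / (2 * Real.pi * Real.sqrt (r ^ 2 - y ^ 2))) y := by
    intro y hy
    have h1 : y / r ≠ -1 := by
      rw [Ne, div_eq_iff hr.ne']; linarith [hy.1]
    have h2 : y / r ≠ 1 := by
      rw [Ne, div_eq_iff hr.ne']; linarith [hy.2]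
    have := (((Real.hasDerivAt_arcsin h1 h2).comp y ((hasDerivAt_id y).div_const r))).const_mul
      (2 * Real.pi)⁻¹
    convert! this using 1
    have e : 1 - (y / r) ^ 2 = (r ^ 2 - y ^ 2) / r ^ 2 := by field_simp
    rw [e, Real.sqrt_div' _ (sq_nonneg r), Real.sqrt_sq hr.le]
    have : 0 < Real.sqrt (r ^ 2 - y ^ 2) := Real.sqrt_pos.2 (by nlinarith [hy.1, hy.2])
    field_simp
  have hi := intervalIntegral.integrableOn_deriv_of_nonneg hcont hderiv
    fun y _ => by positivity
  have hle : -r ≤ r := by linarith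
  rw [restrict_Ioo_eq_restrict_Ioc, ← ofReal_integral_eq_lintegral_ofReal hi
    (ae_of_all _ fun y => by simp only [Pi.zero_apply]; positivity),
    ← intervalIntegral.integral_of_le hle,
    intervalIntegral.integral_eq_sub_of_hasDerivAt_of_le hle hcont hderiv
      ((intervalIntegrable_iff_integrableOn_Ioc_of_le hle).2 hi),
    neg_div, div_self hr.ne', Real.arcsin_one, Real.arcsin_neg_one]
  have : (2 * Real.pi)⁻¹ * (Real.pi / 2) - (2 * Real.pi)⁻¹ * -(Real.pi / 2) = 2⁻¹ := by
    field_simp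
    norm_num
  rw [this, ENNReal.ofReal_inv_of_pos two_pos]
  simp

lemma lintegral_archimedeanDensity (x : ℝ) :
    ∫⁻ y, archimedeanDensity x y = (Set.Ioo (-1 : ℝ) 1).indicator (fun _ => 2⁻¹) x := by
  by_cases hx : x ∈ Set.Ioo (-1 : ℝ) 1
  · have h : 0 < 1 - x ^ 2 := by nlinarith [hx.1, hx.2]
    have hs := Real.sq_sqrt h.le
    rw [Set.indicator_of_mem hx, ← lintegral_inv_sqrt (Real.sqrt_pos.2 h),
      ← lintegral_indicator measurableSet_Ioo]
    refine lintegral_congr fun y => ?_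
    have hm : y ∈ Set.Ioo (-√(1 - x ^ 2)) (√(1 - x ^ 2)) ↔ x ^ 2 + y ^ 2 < 1 := by
      rw [Set.mem_Ioo, ← abs_lt, Real.lt_sqrt (abs_nonneg y), sq_abs]
      constructor <;> intro <;> linarith
    simp only [archimedeanDensity, Set.indicator, hm, Set.mem_ofPred_eq, hs]
  · rw [Set.indicator_of_notMem hx, ← lintegral_zero (μ := (volume : Measure ℝ))]
    refine lintegral_congr fun y => Set.indicator_of_notMem (fun h => hx ?_) _
    have h' : x ^ 2 + y ^ 2 < 1 := h
    exact abs_lt.1 ((sq_lt_one_iff_abs_lt_one x).1 (by linarith [sq_nonneg y]))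

lemma measurePreserving_coords :
    MeasurePreserving (fun p : Plane => (p 0, p 1)) volume volume :=
  (volume_preserving_finTwoArrow ℝ).comp (PiLp.volume_preserving_ofLp (Fin 2))

lemma archimedeanMeasure_map_zero : archimedeanMeasure.map (fun p => p 0) = uniform := by
  ext s hs
  have hm : Measurable fun z : ℝ × ℝ => s.indicator (fun _ => (1 : ℝ≥0∞)) z.1 *
      archimedeanDensity z.1 z.2 :=
    ((measurable_const.indicator hs).comp measurable_fst).mul measurable_archimedeanDensity
  calc archimedeanMeasure.map (fun p => p 0) s
      = ∫⁻ p : Plane, s.indicator (fun _ => (1 : ℝ≥0∞)) (p 0) * archimedeanDensity (p 0) (p 1) := by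
        rw [Measure.map_apply (measurable_coord 0) hs, archimedeanMeasure_eq,
          withDensity_apply _ (measurable_coord 0 hs),
          ← lintegral_indicator (measurable_coord 0 hs)]
        refine lintegral_congr fun p => ?_
        by_cases h : p 0 ∈ s
        · rw [Set.indicator_of_mem h, Set.indicator_of_mem (show p ∈ _ from h), one_mul]
        · rw [Set.indicator_of_notMem h, Set.indicator_of_notMem (show p ∉ _ from h), zero_mul]
    _ = ∫⁻ z : ℝ × ℝ, s.indicator (fun _ => (1 : ℝ≥0∞)) z.1 * archimedeanDensity z.1 z.2 :=
        measurePreserving_coords.lintegral_comp hm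
    _ = ∫⁻ x in s, (Set.Ioo (-1 : ℝ) 1).indicator (fun _ => 2⁻¹) x := by
        rw [Measure.volume_eq_prod, lintegral_prod _ hm.aemeasurable, ← lintegral_indicator hs]
        refine lintegral_congr fun x => ?_
        by_cases h : x ∈ s
        · simp [h, lintegral_archimedeanDensity]
        · simp [h]
    _ = uniform s := by
        rw [lintegral_indicator_const measurableSet_Ioo, uniform_eq, Measure.smul_apply,
          smul_eq_mul, ← restrict_Ioo_eq_restrict_Icc, Measure.restrict_apply measurableSet_Ioo,
          Measure.restrict_apply hs, Set.inter_comm]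

/-- By rotation invariance every direction reduces to the first coordinate. -/
lemma archimedeanMeasure_map_direction (a : ℝ) :
    archimedeanMeasure.map (fun p => Real.cos a * p 0 + Real.sin a * p 1) = uniform := by
  have h := archimedeanMeasure_map_zero
  rw [← archimedeanMeasure_map_isometry (rotation (-a)), Measure.map_map (measurable_coord 0)
    (rotation (-a)).continuous.measurable] at h
  rw [← h]
  congr 1
  ext p
  simp [rotation_zero]

instance : IsProbabilityMeasure archimedeanMeasure := by
  have h := archimedeanMeasure_map_zero
  have : IsProbabilityMeasure (archimedeanMeasure.map fun p : Plane => p 0) := by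
    rw [h]; infer_instance
  exact (Measure.isProbabilityMeasure_map_iff (measurable_coord 0).aemeasurable).1 this

/-- The pair of projections in the directions of angle `-a` and `a`. -/
noncomputable def symmetricPair (a : ℝ) (p : Plane) : Plane :=
  !₂[Real.cos a * p 0 - Real.sin a * p 1, Real.cos a * p 0 + Real.sin a * p 1]

lemma measurable_direction (a b : ℝ) : Measurable fun p : Plane => a * p 0 + b * p 1 :=
  ((measurable_coord 0).const_mul a).add ((measurable_coord 1).const_mul b)

lemma measurable_symmetricPair (a : ℝ) : Measurable (symmetricPair a) := by
  refine measurable_vec ?_ (measurable_direction _ _)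
  simpa [sub_eq_add_neg] using measurable_direction (Real.cos a) (-Real.sin a)

lemma measurable_archimedeanProcess (t : I) : Measurable (archimedeanProcess t) :=
  measurable_direction _ _

/-- Rotating by half the angle `πt` replaces the directions `0` and `πt` by `∓πt/2`. In this form
half-sum and half-difference are `cos a * p 0` and `sin a * p 1`, and using the same point `p` at
two times gives a good coupling. -/
lemma archimedeanPath_eq_map_symmetricPair (t : I) :
    archimedeanPath t = archimedeanMeasure.map (symmetricPair (Real.pi * t / 2)) := by
  rw [archimedeanPath]
  nth_rw 1 [← archimedeanMeasure_map_isometry (rotation (Real.pi * t / 2))]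
  rw [Measure.map_map (measurable_vec (measurable_archimedeanProcess _)
    (measurable_archimedeanProcess _)) (rotation _).continuous.measurable]
  congr 1
  ext p i
  set a := Real.pi * (t : ℝ) / 2 with ha
  have hta : Real.pi * (t : ℝ) = 2 * a := by rw [ha]; ring
  fin_cases i
  · simp [archimedeanProcess, symmetricPair, rotation_zero]
  · simp only [archimedeanProcess, symmetricPair, Function.comp, rotation_zero, rotation_one, hta,
      Fin.mk_one, PiLp.toLp_apply, Matrix.cons_val_one, Matrix.cons_val_fin_one]
    rw [Real.sin_two_mul, Real.cos_two_mul]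
    have := Real.sin_sq_add_cos_sq a
    linear_combination (2 * Real.cos a * p 0) * this

lemma map_archimedeanProcess (t : I) : archimedeanMeasure.map (archimedeanProcess t) = uniform :=
  archimedeanMeasure_map_direction _

lemma isPermuton_archimedeanPath (t : I) : IsPermuton (archimedeanPath t) := by
  have hm := measurable_vec (measurable_archimedeanProcess 0) (measurable_archimedeanProcess t)
  have h0 : (archimedeanPath t).map (fun p => p 0) = uniform := by
    rw [archimedeanPath, Measure.map_map (measurable_coord 0) hm]
    exact map_archimedeanProcess 0
  have h1 : (archimedeanPath t).map (fun p => p 1) = uniform := by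
    rw [archimedeanPath, Measure.map_map (measurable_coord 1) hm]
    exact map_archimedeanProcess t
  refine ⟨Measure.isProbabilityMeasure_map hm.aemeasurable, ?_, h0, h1⟩
  have ha : ∀ i : Fin 2, ∀ᵐ p ∂archimedeanPath t, p i ∈ Set.Icc (-1 : ℝ) 1 := by
    intro i
    refine ae_of_ae_map (f := fun p : Plane => p i) (measurable_coord i).aemeasurable ?_
    fin_cases i
    · change ∀ᵐ y ∂(archimedeanPath t).map (fun p => p 0), _
      rw [h0]; exact ae_uniform_mem
    · change ∀ᵐ y ∂(archimedeanPath t).map (fun p => p 1), _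
      rw [h1]; exact ae_uniform_mem
  exact ae_all_iff.2 ha

lemma archimedeanPath_zero : archimedeanPath 0 = idPermuton := by
  have hm : Measurable fun x : ℝ => (!₂[x, x] : Plane) := measurable_vec measurable_id measurable_id
  rw [idPermuton, ← map_archimedeanProcess 0, Measure.map_map hm (measurable_archimedeanProcess 0)]
  rfl

lemma archimedeanPath_one : archimedeanPath 1 = revPermuton := by
  have hm : Measurable fun x : ℝ => (!₂[x, -x] : Plane) :=
    measurable_vec measurable_id measurable_id.neg
  rw [revPermuton, ← map_archimedeanProcess 0,
    Measure.map_map hm (measurable_archimedeanProcess 0), archimedeanPath]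
  congr 1
  ext p
  simp [archimedeanProcess]

lemma wasserstein_archimedeanPath_sq_le (s t : I) :
    wasserstein (archimedeanPath s) (archimedeanPath t) ^ 2 ≤
      ENNReal.ofReal (Real.pi ^ 2 / 6 * ((t : ℝ) - s) ^ 2) := by
  rw [archimedeanPath_eq_map_symmetricPair, archimedeanPath_eq_map_symmetricPair]
  refine (wasserstein_map_sq_le _ (measurable_symmetricPair _) (measurable_symmetricPair _)).trans ?_
  set a := Real.pi * (s : ℝ) / 2 with ha
  set b := Real.pi * (t : ℝ) / 2 with hb
  have hX0 : MemLp (fun p : Plane => p 0) 2 archimedeanMeasure :=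
    memLp_of_map_uniform (measurable_coord 0) archimedeanMeasure_map_zero
  have h1 : archimedeanMeasure.map (fun p => p 1) = uniform := by
    simpa using archimedeanMeasure_map_direction (Real.pi / 2)
  have hX1 : MemLp (fun p : Plane => p 1) 2 archimedeanMeasure :=
    memLp_of_map_uniform (measurable_coord 1) h1
  have he : ∀ p, edist (symmetricPair a p) (symmetricPair b p) ^ 2 = ENNReal.ofReal
      (2 * (Real.cos a - Real.cos b) ^ 2 * p 0 ^ 2 + 2 * (Real.sin a - Real.sin b) ^ 2 * p 1 ^ 2) := by
    intro p
    rw [plane_edist_sq]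
    congr 1
    simp only [symmetricPair, PiLp.toLp_apply, Matrix.cons_val_zero, Matrix.cons_val_one,
      Matrix.cons_val_fin_one]
    ring
  have hi : Integrable (fun p : Plane => 2 * (Real.cos a - Real.cos b) ^ 2 * p 0 ^ 2 +
      2 * (Real.sin a - Real.sin b) ^ 2 * p 1 ^ 2) archimedeanMeasure :=
    (hX0.integrable_sq.const_mul _).add (hX1.integrable_sq.const_mul _)
  simp only [he]
  rw [← ofReal_integral_eq_lintegral_ofReal hi
    (ae_of_all _ fun p => by simp only [Pi.zero_apply]; positivity)]
  refine ENNReal.ofReal_le_ofReal ?_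
  rw [integral_add (hX0.integrable_sq.const_mul _) (hX1.integrable_sq.const_mul _),
    integral_const_mul, integral_const_mul,
    integral_sq_of_map_uniform (measurable_coord 0) archimedeanMeasure_map_zero,
    integral_sq_of_map_uniform (measurable_coord 1) h1]
  -- The cost of the coupling is `4/3 (1 - cos (b - a))`, at most `2/3 (b - a)²` with `b - a = π/2
  -- (t - s)`.
  have hcos := Real.one_sub_sq_div_two_le_cos (x := b - a)
  rw [Real.cos_sub] at hcos
  have hba : b - a = Real.pi / 2 * (t - s) := by rw [ha, hb]; ring
  rw [hba] at hcos
  nlinarith [Real.sin_sq_add_cos_sq a, Real.sin_sq_add_cos_sq b]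

lemma isPermutonPath_archimedeanPath : IsPermutonPath archimedeanPath := by
  refine ⟨isPermuton_archimedeanPath, fun t => ?_⟩
  have h : Tendsto (fun s : I => ENNReal.ofReal (Real.pi ^ 2 / 6 * ((t : ℝ) - s) ^ 2)) (𝓝 t)
      (𝓝 0) := by
    have : Continuous fun s : I => ENNReal.ofReal (Real.pi ^ 2 / 6 * ((t : ℝ) - s) ^ 2) :=
      ENNReal.continuous_ofReal.comp (by fun_prop)
    simpa using this.tendsto t
  have hW := tendsto_of_tendsto_of_tendsto_of_le_of_le tendsto_const_nhds h (fun _ => zero_le)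
    fun s => wasserstein_archimedeanPath_sq_le s t
  have := (ENNReal.continuous_rpow_const (y := (1 / 2 : ℝ))).tendsto 0 |>.comp hW
  rw [ENNReal.zero_rpow_of_pos (by norm_num)] at this
  refine this.congr fun s => ?_
  rw [Function.comp, ← ENNReal.rpow_natCast, ← ENNReal.rpow_mul]
  norm_num

lemma energy_archimedeanPath_le :
    energy wasserstein archimedeanPath ≤ ENNReal.ofReal (Real.pi ^ 2 / 6) := by
  refine iSup_le fun n => iSup_le fun t => iSup_le fun ht => iSup_le fun h0 => iSup_le fun h1 => ?_
  calc _ ≤ ∑ i : Fin n, ENNReal.ofReal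
        (Real.pi ^ 2 / 6 * ((t i.succ : ℝ) - (t i.castSucc : ℝ))) := by
        refine Finset.sum_le_sum fun i _ => ?_
        have hpos : 0 < (t i.succ : ℝ) - (t i.castSucc : ℝ) :=
          sub_pos.2 (ht (Fin.castSucc_lt_succ (i := i)))
        refine ENNReal.div_le_of_le_mul ?_
        rw [← ENNReal.ofReal_mul' hpos.le, mul_assoc, ← sq]
        exact wasserstein_archimedeanPath_sq_le _ _
    _ = ENNReal.ofReal (∑ i : Fin n, Real.pi ^ 2 / 6 *
        ((t i.succ : ℝ) - (t i.castSucc : ℝ))) := by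
        refine (ENNReal.ofReal_sum_of_nonneg fun i _ => ?_).symm
        exact mul_nonneg (by positivity) (sub_nonneg.2 (ht (Fin.castSucc_lt_succ (i := i))).le)
    _ = _ := by
        rw [← Finset.mul_sum, Finset.sum_sub_distrib]
        have e1 := Fin.sum_univ_succ fun i => (t i : ℝ)
        have e2 := Fin.sum_univ_castSucc fun i => (t i : ℝ)
        rw [h0] at e1
        rw [h1] at e2
        have : ∑ i : Fin n, (t i.succ : ℝ) - ∑ i : Fin n, (t i.castSucc : ℝ) = 1 := by
          simp only [Set.Icc.coe_zero, Set.Icc.coe_one] at e1 e2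
          linarith
        rw [this, mul_one]

/-! ### The energy bound and the first consequences of equality. -/

section Energy

variable {μ : I → Measure Plane}

/-- Let `t` decrease to `s` in `three_block_le_energy`, dropping the Wasserstein term. -/
lemma two_block_le_energy (hμ : IsPermutonPath μ) {s : I} (hs : 0 < s) (hs1 : s < 1) :
    ENNReal.ofReal (2 / 3 * (angle (μ s) - angle (μ 0)) ^ 2 / s +
      2 / 3 * (angle (μ 1) - angle (μ s)) ^ 2 / (1 - s)) ≤ energy wasserstein μ := by
  have hs1' : (s : ℝ) < 1 := hs1
  have hne : (𝓝[>] s).NeBot := nhdsGT_neBot_of_exists_gt ⟨1, hs1⟩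
  have hlim : Tendsto (fun t : I => ENNReal.ofReal (2 / 3 * (angle (μ s) - angle (μ 0)) ^ 2 / s +
      2 / 3 * (angle (μ 1) - angle (μ t)) ^ 2 / (1 - t))) (𝓝[>] s)
      (𝓝 (ENNReal.ofReal (2 / 3 * (angle (μ s) - angle (μ 0)) ^ 2 / s +
        2 / 3 * (angle (μ 1) - angle (μ s)) ^ 2 / (1 - s)))) := by
    refine ENNReal.tendsto_ofReal (Tendsto.mono_left ?_ nhdsWithin_le_nhds)
    have hφ := hμ.continuous_angle.tendsto s
    have hid : Tendsto (fun t : I => (t : ℝ)) (𝓝 s) (𝓝 (s : ℝ)) := continuous_subtype_val.tendsto s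
    exact tendsto_const_nhds.add ((((tendsto_const_nhds.sub hφ).pow 2).const_mul _).div
      (tendsto_const_nhds.sub hid) (by linarith))
  refine le_of_tendsto hlim ?_
  filter_upwards [self_mem_nhdsWithin, mem_nhdsWithin_of_mem_nhds (Iio_mem_nhds hs1)] with t h1 h2
  exact le_self_add.trans (three_block_le_energy hμ.isPermuton hs h1 h2)

/-- Completing the square in `x`: the remainder vanishes only at `x = πs/2`, which gives both the
energy bound and the linear angle. -/
lemma two_block_eq {s x : ℝ} (hs : 0 < s) (hs1 : s < 1) :
    2 / 3 * (x - 0) ^ 2 / s + 2 / 3 * (Real.pi / 2 - x) ^ 2 / (1 - s) =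
      Real.pi ^ 2 / 6 + 2 / 3 * (x - Real.pi * s / 2) ^ 2 / (s * (1 - s)) := by
  have : 1 - s ≠ 0 := by linarith
  field_simp
  ring

lemma le_energy (hμ : IsPermutonPath μ) (h0 : μ 0 = idPermuton) (h1 : μ 1 = revPermuton) :
    ENNReal.ofReal (Real.pi ^ 2 / 6) ≤ energy wasserstein μ := by
  have hs : (0 : I) < ⟨1 / 2, by norm_num, by norm_num⟩ := Subtype.coe_lt_coe.1 (by norm_num)
  have hs1 : (⟨1 / 2, by norm_num, by norm_num⟩ : I) < 1 := Subtype.coe_lt_coe.1 (by norm_num)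
  refine le_trans (ENNReal.ofReal_le_ofReal ?_) (two_block_le_energy hμ hs hs1)
  rw [h0, h1, angle_idPermuton, angle_revPermuton, two_block_eq hs hs1]
  norm_num
  positivity

lemma angle_eq_of_energy_le (hμ : IsPermutonPath μ) (h0 : μ 0 = idPermuton)
    (h1 : μ 1 = revPermuton) (hE : energy wasserstein μ ≤ ENNReal.ofReal (Real.pi ^ 2 / 6)) {s : I}
    (hs : 0 < s) (hs1 : s < 1) : angle (μ s) = Real.pi * s / 2 := by
  have hs' : (0 : ℝ) < s := hs
  have hs1' : (s : ℝ) < 1 := hs1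
  have h := (two_block_le_energy hμ hs hs1).trans hE
  rw [ENNReal.ofReal_le_ofReal_iff (by positivity), h0, h1, angle_idPermuton, angle_revPermuton,
    two_block_eq hs' hs1'] at h
  have hp : 0 < (s : ℝ) * (1 - s) := mul_pos hs' (by linarith)
  have h2 : 2 / 3 * (angle (μ s) - Real.pi * s / 2) ^ 2 / (s * (1 - s)) ≤ 0 := by linarith
  rw [div_le_iff₀ hp, zero_mul] at h2
  have h3 : (angle (μ s) - Real.pi * s / 2) ^ 2 = 0 :=
    le_antisymm (by linarith) (sq_nonneg _)
  exact sub_eq_zero.1 (pow_eq_zero_iff two_ne_zero |>.1 h3)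

/-- With the angle linear, the outer blocks `[0, s]` and `[t, 1]` already use energy `π²/6 (1 - (t -
s))`, leaving `π²/6 (t - s)` for the jump from `s` to `t`. -/
lemma wasserstein_sq_le_of_energy_le (hμ : IsPermutonPath μ) (h0 : μ 0 = idPermuton)
    (h1 : μ 1 = revPermuton) (hE : energy wasserstein μ ≤ ENNReal.ofReal (Real.pi ^ 2 / 6))
    {s t : I} (hs : 0 < s) (hst : s < t) (ht : t < 1) :
    wasserstein (μ s) (μ t) ^ 2 ≤ ENNReal.ofReal (Real.pi ^ 2 / 6 * ((t : ℝ) - s) ^ 2) := by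
  have hs' : (0 : ℝ) < s := hs
  have hst' : (s : ℝ) < t := hst
  have ht' : (t : ℝ) < 1 := ht
  have h := (three_block_le_energy hμ.isPermuton hs hst ht).trans hE
  rw [h0, h1, angle_idPermuton, angle_revPermuton,
    angle_eq_of_energy_le hμ h0 h1 hE hs (hst.trans ht),
    angle_eq_of_energy_le hμ h0 h1 hE (hs.trans hst) ht] at h
  have e : 2 / 3 * (Real.pi * s / 2 - 0) ^ 2 / s +
      2 / 3 * (Real.pi / 2 - Real.pi * t / 2) ^ 2 / (1 - t) =
      Real.pi ^ 2 / 6 - Real.pi ^ 2 / 6 * ((t : ℝ) - s) := by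
    have : 1 - (t : ℝ) ≠ 0 := by linarith
    field_simp
    ring
  rw [e] at h
  have h2 := ENNReal.le_sub_of_add_le_left ENNReal.ofReal_ne_top h
  rw [← ENNReal.ofReal_sub _ (by nlinarith [sq_nonneg Real.pi]), sub_sub_cancel,
    ENNReal.div_le_iff (by simpa using hst) ENNReal.ofReal_ne_top,
    ← ENNReal.ofReal_mul' (by linarith)] at h2
  rwa [sq ((t : ℝ) - s), ← mul_assoc]

end Energy

/-! ### Stability of Cauchy–Schwarz, measured by characteristic functions of normalized laws. -/

section CharFun

variable {Ω : Type*} [MeasurableSpace Ω] {ρ : Measure Ω}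

lemma norm_exp_mul_I_sub_le (x y : ℝ) :
    ‖Complex.exp (x * Complex.I) - Complex.exp (y * Complex.I)‖ ≤ |x - y| := by
  have e : Complex.exp (x * Complex.I) - Complex.exp (y * Complex.I) =
      Complex.exp (y * Complex.I) * (Complex.exp (Complex.I * (x - y : ℝ)) - 1) := by
    rw [mul_sub, ← Complex.exp_add, mul_one]
    congr 2
    push_cast
    ring
  rw [e, norm_mul, Complex.norm_exp_ofReal_mul_I, one_mul]
  exact Real.norm_exp_I_mul_ofReal_sub_one_le

/-- The map `x ↦ exp (i x)` is 1-Lipschitz, and the `L¹` norm is at most the `L²` norm for a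
probability measure. -/
lemma norm_integral_exp_sub_sq_le [IsProbabilityMeasure ρ] {f g : Ω → ℝ} (hf : Measurable f)
    (hg : Measurable g) (hfg : MemLp (fun ω => f ω - g ω) 2 ρ) :
    ‖∫ ω, Complex.exp (f ω * Complex.I) ∂ρ - ∫ ω, Complex.exp (g ω * Complex.I) ∂ρ‖ ^ 2 ≤
      ∫ ω, (f ω - g ω) ^ 2 ∂ρ := by
  have hi : ∀ {h : Ω → ℝ}, Measurable h → Integrable (fun ω => Complex.exp (h ω * Complex.I)) ρ :=
    fun {h} hh => Integrable.of_bound (by fun_prop) 1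
      (ae_of_all _ fun ω => (Complex.norm_exp_ofReal_mul_I _).le)
  rw [← integral_sub (hi hf) (hi hg)]
  have h1 : ‖∫ ω, (Complex.exp (f ω * Complex.I) - Complex.exp (g ω * Complex.I)) ∂ρ‖ ≤
      ∫ ω, |f ω - g ω| ∂ρ :=
    (norm_integral_le_integral_norm _).trans (integral_mono ((hi hf).sub (hi hg)).norm
      (hfg.integrable one_le_two).abs fun ω => norm_exp_mul_I_sub_le _ _)
  have h2 := sq_integral_mul_le hfg.abs (memLp_const (μ := ρ) (p := 2) (1 : ℝ))
  simp only [mul_one, one_pow, integral_const, probReal_univ, smul_eq_mul, Pi.abs_apply, sq_abs]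
    at h2
  exact (pow_le_pow_left₀ (norm_nonneg _) h1 2).trans h2

/-- An exact form of the Cauchy–Schwarz deficit: `(c - d)² / 3` is the least value of `E (X - Y)²`
allowed by the second moments when `c` and `d` have the same sign, and the excess is the distance
between the normalized variables. -/
lemma mul_integral_normalized_sub_sq {X Y : Ω → ℝ} (hX : MemLp X 2 ρ) (hY : MemLp Y 2 ρ)
    {c d : ℝ} (hc : c ≠ 0) (hd : d ≠ 0) (hX2 : ∫ ω, X ω ^ 2 ∂ρ = c ^ 2 / 3)
    (hY2 : ∫ ω, Y ω ^ 2 ∂ρ = d ^ 2 / 3) :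
    c * d * ∫ ω, (c⁻¹ * X ω - d⁻¹ * Y ω) ^ 2 ∂ρ = ∫ ω, (X ω - Y ω) ^ 2 ∂ρ - (c - d) ^ 2 / 3 := by
  have e : ∀ ω, c⁻¹ * X ω * (d⁻¹ * Y ω) = (c * d)⁻¹ * (X ω * Y ω) := fun ω => by
    rw [mul_inv]; ring
  rw [integral_sub_sq (hX.const_mul c⁻¹) (hY.const_mul d⁻¹), integral_sub_sq hX hY]
  simp only [mul_pow, e, integral_const_mul, hX2, hY2]
  field_simp
  ring

end CharFun

/-- The half-sum and half-difference of the coordinates, rescaled by `cos a` and `sin a`. -/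
noncomputable def normalize (a : ℝ) (p : Plane) : Plane :=
  !₂[(Real.cos a)⁻¹ * halfSum p, (Real.sin a)⁻¹ * halfDiff p]

lemma measurable_normalize (a : ℝ) : Measurable (normalize a) :=
  measurable_vec (measurable_halfSum.const_mul _) (measurable_halfDiff.const_mul _)

/-- A permuton is thus recovered from its normalized law and its angle, away from the endpoints. -/
lemma symmetricPair_normalize {a : ℝ} (hc : Real.cos a ≠ 0) (hs : Real.sin a ≠ 0) (p : Plane) :
    symmetricPair a (normalize a p) = p := by
  ext i
  fin_cases i
  all_goals
    simp [symmetricPair, normalize, hc, hs, halfSum, halfDiff]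
    ring

lemma charFun_map_plane {Ω : Type*} [MeasurableSpace Ω] {ρ : Measure Ω} {f : Ω → Plane}
    (hf : Measurable f) (ξ : Plane) : charFun (ρ.map f) ξ =
      ∫ ω, Complex.exp ((ξ 0 * f ω 0 + ξ 1 * f ω 1 : ℝ) * Complex.I) ∂ρ := by
  rw [charFun_apply, integral_map hf.aemeasurable (by fun_prop)]
  simp [PiLp.inner_apply, Fin.sum_univ_two]

/-- The law of the normalized half-sum and half-difference under a permuton. -/
noncomputable def normalizedLaw (μ : Measure Plane) : Measure Plane :=
  μ.map (normalize (angle μ))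

namespace IsPermuton

variable {μ ν : Measure Plane}

lemma map_eq_map_comp_fst {β : Type*} [MeasurableSpace β] {π : Measure (Plane × Plane)}
    {f : Plane → β} (h₁ : π.fst = μ) (hf : Measurable f) : μ.map f = π.map fun z => f z.1 := by
  rw [← h₁, Measure.fst, Measure.map_map hf measurable_fst]
  rfl

lemma map_eq_map_comp_snd {β : Type*} [MeasurableSpace β] {π : Measure (Plane × Plane)}
    {f : Plane → β} (h₂ : π.snd = ν) (hf : Measurable f) : ν.map f = π.map fun z => f z.2 := by
  rw [← h₂, Measure.snd, Measure.map_map hf measurable_snd]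
  rfl

/-- The excess of the cost over its lower bound equals `2 cos θ cos θ' U + 2 sin θ sin θ' V`, where
`U` and `V` are the mean squared differences of the normalized coordinates. The constant `m` keeps
both weights away from zero. -/
lemma charFun_normalizedLaw_le_coupling {π : Measure (Plane × Plane)} (hμ : IsPermuton μ)
    (hν : IsPermuton ν) (h₁ : π.fst = μ) (h₂ : π.snd = ν) {m : ℝ} (hm : 0 < m)
    (hc : m ≤ Real.cos (angle μ) * Real.cos (angle ν))
    (hs : m ≤ Real.sin (angle μ) * Real.sin (angle ν)) (ξ : Plane) :
    m * ‖charFun (normalizedLaw μ) ξ - charFun (normalizedLaw ν) ξ‖ ^ 2 ≤ ‖ξ‖ ^ 2 *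
      ((2 * ∫ z, (halfSum z.1 - halfSum z.2) ^ 2 ∂π +
        2 * ∫ z, (halfDiff z.1 - halfDiff z.2) ^ 2 ∂π) -
        4 / 3 * (1 - Real.cos (angle μ - angle ν))) := by
  have : IsProbabilityMeasure μ := hμ.isProbabilityMeasure
  have : IsProbabilityMeasure π := ⟨by rw [← Measure.fst_univ, h₁, measure_univ]⟩
  set c := Real.cos (angle μ)
  set d := Real.cos (angle ν)
  set s := Real.sin (angle μ)
  set r := Real.sin (angle ν)
  have hcd : c * d ≠ 0 := (hm.trans_le hc).ne'
  have hsr : s * r ≠ 0 := (hm.trans_le hs).ne'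
  have hU := mul_integral_normalized_sub_sq (memLp_fst h₁ hμ.memLp_halfSum)
    (memLp_snd h₂ hν.memLp_halfSum) (left_ne_zero_of_mul hcd) (right_ne_zero_of_mul hcd)
    ((integral_fst_sq h₁ measurable_halfSum).trans hμ.integral_halfSum_sq)
    ((integral_snd_sq h₂ measurable_halfSum).trans hν.integral_halfSum_sq)
  have hV := mul_integral_normalized_sub_sq (memLp_fst h₁ hμ.memLp_halfDiff)
    (memLp_snd h₂ hν.memLp_halfDiff) (left_ne_zero_of_mul hsr) (right_ne_zero_of_mul hsr)
    ((integral_fst_sq h₁ measurable_halfDiff).trans hμ.integral_halfDiff_sq)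
    ((integral_snd_sq h₂ measurable_halfDiff).trans hν.integral_halfDiff_sq)
  have hUL : MemLp (fun z : Plane × Plane => c⁻¹ * halfSum z.1 - d⁻¹ * halfSum z.2) 2 π :=
    ((memLp_fst h₁ hμ.memLp_halfSum).const_mul _).sub ((memLp_snd h₂ hν.memLp_halfSum).const_mul _)
  have hVL : MemLp (fun z : Plane × Plane => s⁻¹ * halfDiff z.1 - r⁻¹ * halfDiff z.2) 2 π :=
    ((memLp_fst h₁ hμ.memLp_halfDiff).const_mul _).sub
      ((memLp_snd h₂ hν.memLp_halfDiff).const_mul _)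
  set U := ∫ z, (c⁻¹ * halfSum z.1 - d⁻¹ * halfSum z.2) ^ 2 ∂π
  set V := ∫ z, (s⁻¹ * halfDiff z.1 - r⁻¹ * halfDiff z.2) ^ 2 ∂π
  have hU0 : 0 ≤ U := integral_nonneg fun z => sq_nonneg _
  have hV0 : 0 ≤ V := integral_nonneg fun z => sq_nonneg _
  have e₁ : normalizedLaw μ = π.map fun z => normalize (angle μ) z.1 :=
    map_eq_map_comp_fst h₁ (measurable_normalize _)
  have e₂ : normalizedLaw ν = π.map fun z => normalize (angle ν) z.2 :=
    map_eq_map_comp_snd h₂ (measurable_normalize _)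
  have hmain : ‖charFun (normalizedLaw μ) ξ - charFun (normalizedLaw ν) ξ‖ ^ 2 ≤
      ‖ξ‖ ^ 2 * (U + V) := by
    have m₁ : Measurable fun z : Plane × Plane => normalize (angle μ) z.1 :=
      (measurable_normalize _).comp measurable_fst
    have m₂ : Measurable fun z : Plane × Plane => normalize (angle ν) z.2 :=
      (measurable_normalize _).comp measurable_snd
    rw [e₁, e₂, charFun_map_plane m₁, charFun_map_plane m₂]
    have ed : ∀ z : Plane × Plane, (ξ 0 * normalize (angle μ) z.1 0 +
        ξ 1 * normalize (angle μ) z.1 1) - (ξ 0 * normalize (angle ν) z.2 0 +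
        ξ 1 * normalize (angle ν) z.2 1) = ξ 0 * (c⁻¹ * halfSum z.1 - d⁻¹ * halfSum z.2) +
        ξ 1 * (s⁻¹ * halfDiff z.1 - r⁻¹ * halfDiff z.2) := fun z => by
      simp only [normalize, PiLp.toLp_apply, Matrix.cons_val_zero, Matrix.cons_val_one,
        Matrix.cons_val_fin_one, c, d, s, r]
      ring
    have hL : MemLp (fun z : Plane × Plane => ξ 0 * (c⁻¹ * halfSum z.1 - d⁻¹ * halfSum z.2) +
        ξ 1 * (s⁻¹ * halfDiff z.1 - r⁻¹ * halfDiff z.2)) 2 π :=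
      (hUL.const_mul _).add (hVL.const_mul _)
    have hmeas : ∀ a : ℝ, Measurable fun p : Plane =>
        ξ 0 * normalize a p 0 + ξ 1 * normalize a p 1 := fun a =>
      (measurable_direction (ξ 0) (ξ 1)).comp (measurable_normalize a)
    refine (norm_integral_exp_sub_sq_le ((hmeas _).comp measurable_fst)
      ((hmeas _).comp measurable_snd) (by simpa only [Function.comp, ed] using hL)).trans ?_
    simp only [Function.comp, ed]
    rw [← integral_add hUL.integrable_sq hVL.integrable_sq, ← integral_const_mul]
    refine integral_mono hL.integrable_sq ((hUL.integrable_sq.add hVL.integrable_sq).const_mul _)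
      fun z => ?_
    rw [plane_norm_sq]
    -- Lagrange's identity, that is, Cauchy–Schwarz in the plane.
    nlinarith [sq_nonneg (ξ 0 * (s⁻¹ * halfDiff z.1 - r⁻¹ * halfDiff z.2) -
      ξ 1 * (c⁻¹ * halfSum z.1 - d⁻¹ * halfSum z.2))]
  have hD : (2 * ∫ z, (halfSum z.1 - halfSum z.2) ^ 2 ∂π +
        2 * ∫ z, (halfDiff z.1 - halfDiff z.2) ^ 2 ∂π) -
        4 / 3 * (1 - Real.cos (angle μ - angle ν)) = 2 * (c * d * U) + 2 * (s * r * V) := by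
    rw [hU, hV, Real.cos_sub]
    have e₁ : s ^ 2 + c ^ 2 = 1 := Real.sin_sq_add_cos_sq (angle μ)
    have e₂ : r ^ 2 + d ^ 2 = 1 := Real.sin_sq_add_cos_sq (angle ν)
    change _ - 4 / 3 * (1 - (c * d + s * r)) = _
    linear_combination 2 / 3 * e₁ + 2 / 3 * e₂
  rw [hD]
  calc m * ‖charFun (normalizedLaw μ) ξ - charFun (normalizedLaw ν) ξ‖ ^ 2
      ≤ m * (‖ξ‖ ^ 2 * (U + V)) := by gcongr
    _ = ‖ξ‖ ^ 2 * (m * U + m * V) := by ring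
    _ ≤ ‖ξ‖ ^ 2 * (2 * (c * d * U) + 2 * (s * r * V)) := by
        have h1 := mul_le_mul_of_nonneg_right hc hU0
        have h2 := mul_le_mul_of_nonneg_right hs hV0
        have h3 := mul_nonneg hm.le hU0
        have h4 := mul_nonneg hm.le hV0
        exact mul_le_mul_of_nonneg_left (by linarith) (sq_nonneg _)

/-- The coupling bound passes to the infimum. The factor `‖ξ‖ ^ 2 + 1` replaces `‖ξ‖ ^ 2` so that it
can be divided out; this is harmless because the excess is nonnegative. -/
lemma charFun_normalizedLaw_le (hμ : IsPermuton μ) (hν : IsPermuton ν) {m B : ℝ} (hm : 0 < m)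
    (hc : m ≤ Real.cos (angle μ) * Real.cos (angle ν))
    (hs : m ≤ Real.sin (angle μ) * Real.sin (angle ν)) (hB : 0 ≤ B)
    (hW : wasserstein μ ν ^ 2 ≤ ENNReal.ofReal B) (ξ : Plane) :
    m * ‖charFun (normalizedLaw μ) ξ - charFun (normalizedLaw ν) ξ‖ ^ 2 ≤
      (‖ξ‖ ^ 2 + 1) * (B - 4 / 3 * (1 - Real.cos (angle μ - angle ν))) := by
  have hK : 0 < ‖ξ‖ ^ 2 + 1 := by positivity
  have h : ENNReal.ofReal (4 / 3 * (1 - Real.cos (angle μ - angle ν)) +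
      m * ‖charFun (normalizedLaw μ) ξ - charFun (normalizedLaw ν) ξ‖ ^ 2 / (‖ξ‖ ^ 2 + 1)) ≤
      ENNReal.ofReal B := by
    refine le_trans ?_ hW
    rw [wasserstein_sq]
    refine le_iInf fun π => le_iInf fun h₁ => le_iInf fun h₂ => ?_
    rw [lintegral_edist_sq hμ hν h₁ h₂]
    refine ENNReal.ofReal_le_ofReal ?_
    have h1 := charFun_normalizedLaw_le_coupling hμ hν h₁ h₂ hm hc hs ξ
    have h2 := le_coupling_cost hμ hν h₁ h₂
    rw [← le_sub_iff_add_le', div_le_iff₀ hK]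
    nlinarith
  rw [ENNReal.ofReal_le_ofReal_iff hB, ← le_sub_iff_add_le', div_le_iff₀ hK] at h
  linarith

end IsPermuton

/-! ### Rigidity: the normalized law is constant in time and Archimedean. -/

section Rigidity

variable {μ : I → Measure Plane}

lemma charFun_normalizedLaw_path_le (hμ : IsPermutonPath μ) (h0 : μ 0 = idPermuton)
    (h1 : μ 1 = revPermuton) (hE : energy wasserstein μ ≤ ENNReal.ofReal (Real.pi ^ 2 / 6))
    {s t : I} (hs : 0 < s) (hs1 : s < 1) (ht : 0 < t) (ht1 : t < 1) {m : ℝ} (hm : 0 < m)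
    (hc : m ≤ Real.cos (Real.pi * s / 2) * Real.cos (Real.pi * t / 2))
    (hs' : m ≤ Real.sin (Real.pi * s / 2) * Real.sin (Real.pi * t / 2))
    (hst : |Real.pi / 2 * ((t : ℝ) - s)| ≤ 1) (ξ : Plane) :
    m * ‖charFun (normalizedLaw (μ s)) ξ - charFun (normalizedLaw (μ t)) ξ‖ ^ 2 ≤
      (‖ξ‖ ^ 2 + 1) * (5 / 72 * (Real.pi / 2 * ((t : ℝ) - s)) ^ 4) := by
  wlog h : s ≤ t generalizing s t
  · have := this ht ht1 hs hs1 (by rwa [mul_comm]) (by rwa [mul_comm])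
      (by rwa [← neg_sub, mul_neg, abs_neg]) (le_of_not_ge h)
    rwa [norm_sub_rev, ← neg_sub (t : ℝ), mul_neg, (by decide : Even 4).neg_pow] at this
  rcases h.eq_or_lt with rfl | h
  · simp
  have hφs := angle_eq_of_energy_le hμ h0 h1 hE hs hs1
  have hφt := angle_eq_of_energy_le hμ h0 h1 hE ht ht1
  refine ((hμ.isPermuton s).charFun_normalizedLaw_le (hμ.isPermuton t) hm (by rwa [hφs, hφt])
    (by rwa [hφs, hφt]) (by positivity)
    (wasserstein_sq_le_of_energy_le hμ h0 h1 hE hs h ht1) ξ).trans ?_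
  refine mul_le_mul_of_nonneg_left ?_ (by positivity)
  -- The quadratic terms cancel, and the quartic error `5/96` of the cosine expansion times `4/3`
  -- gives `5/72`.
  have hb := (abs_le.1 (Real.cos_bound hst)).2
  have e : angle (μ s) - angle (μ t) = -(Real.pi / 2 * ((t : ℝ) - s)) := by rw [hφs, hφt]; ring
  rw [e, Real.cos_neg]
  rw [(by decide : Even 4).pow_abs] at hb
  nlinarith

lemma charFun_normalizedLaw_path_eq (hμ : IsPermutonPath μ) (h0 : μ 0 = idPermuton)
    (h1 : μ 1 = revPermuton) (hE : energy wasserstein μ ≤ ENNReal.ofReal (Real.pi ^ 2 / 6))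
    {s t : I} (hs : 0 < s) (hs1 : s < 1) (ht : 0 < t) (ht1 : t < 1) (ξ : Plane) :
    charFun (normalizedLaw (μ s)) ξ = charFun (normalizedLaw (μ t)) ξ := by
  -- `Set.projIcc` extends the path to all real times so that calculus on the open interval `(0, 1)`
  -- applies.
  let F : ℝ → ℂ := fun x => charFun (normalizedLaw (μ (Set.projIcc 0 1 zero_le_one x))) ξ
  have hF : ∀ x ∈ Set.Ioo (0 : ℝ) 1, HasFDerivAt F (0 : ℝ →L[ℝ] ℂ) x := by
    intro x hx
    have hcx : 0 < Real.cos (Real.pi * x / 2) := Real.cos_pos_of_mem_Ioo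
      ⟨by nlinarith [hx.1, Real.pi_pos], by nlinarith [hx.2, Real.pi_pos]⟩
    have hsx : 0 < Real.sin (Real.pi * x / 2) := Real.sin_pos_of_pos_of_lt_pi
      (by nlinarith [hx.1, Real.pi_pos]) (by nlinarith [hx.2, Real.pi_pos])
    -- Strictly below `cos²` and `sin²` at `x`, hence still below the mixed products for `y` near
    -- `x`.
    obtain ⟨m, hm, hmlt⟩ := exists_between (lt_min (mul_pos hcx hcx) (mul_pos hsx hsx))
    rw [lt_min_iff] at hmlt
    set C := (‖ξ‖ ^ 2 + 1) * (5 / 72 * (Real.pi / 2) ^ 4) / m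
    have hO : (fun y => F y - F x) =O[𝓝 x] fun y => ‖y - x‖ ^ 2 := by
      refine Asymptotics.IsBigO.of_bound (Real.sqrt C) ?_
      have hc : ∀ᶠ y in 𝓝 x, m < Real.cos (Real.pi * x / 2) * Real.cos (Real.pi * y / 2) :=
        (Continuous.tendsto (by fun_prop) x).eventually_const_lt hmlt.1
      have hs : ∀ᶠ y in 𝓝 x, m < Real.sin (Real.pi * x / 2) * Real.sin (Real.pi * y / 2) :=
        (Continuous.tendsto (by fun_prop) x).eventually_const_lt hmlt.2
      have ha : ∀ᶠ y in 𝓝 x, |Real.pi / 2 * (y - x)| < 1 :=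
        (Continuous.tendsto (by fun_prop) x).eventually_lt_const (by simp)
      filter_upwards [hc, hs, ha, Ioo_mem_nhds hx.1 hx.2] with y hc hs ha hy
      have ex : Set.projIcc 0 1 zero_le_one x = (⟨x, hx.1.le, hx.2.le⟩ : I) :=
        Set.projIcc_of_mem _ _
      have ey : Set.projIcc 0 1 zero_le_one y = (⟨y, hy.1.le, hy.2.le⟩ : I) :=
        Set.projIcc_of_mem _ _
      have h := charFun_normalizedLaw_path_le hμ h0 h1 hE (s := ⟨x, hx.1.le, hx.2.le⟩)
        (t := ⟨y, hy.1.le, hy.2.le⟩) hx.1 hx.2 hy.1 hy.2 hm hc.le hs.le ha.le ξ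
      rw [← ex, ← ey] at h
      change m * ‖F x - F y‖ ^ 2 ≤ _ at h
      have h2 : ‖F y - F x‖ ^ 2 ≤ C * (‖y - x‖ ^ 2) ^ 2 := by
        rw [norm_sub_rev, Real.norm_eq_abs, sq_abs]
        rw [div_mul_eq_mul_div, le_div_iff₀ hm]
        rw [ex, ey] at h
        calc _ = m * ‖F x - F y‖ ^ 2 := mul_comm _ _
          _ ≤ _ := h
          _ = _ := by ring
      rw [norm_pow, norm_norm]
      refine le_of_sq_le_sq ?_ (by positivity)
      rw [mul_pow, Real.sq_sqrt (by positivity)]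
      exact h2
    have := (hO.hasFDerivAt (𝕜 := ℝ) one_lt_two).add_const (F x)
    simpa using this
  have hconst := isOpen_Ioo.is_const_of_fderiv_eq_zero (𝕜 := ℝ) isPreconnected_Ioo
    (fun x hx => (hF x hx).differentiableAt.differentiableWithinAt)
    (fun x hx => (hF x hx).fderiv) (x := (s : ℝ)) (y := (t : ℝ)) ⟨hs, hs1⟩ ⟨ht, ht1⟩
  simpa [F, Set.projIcc_val] using hconst

lemma integral_exp_of_map_uniform {Ω : Type*} [MeasurableSpace Ω] {ρ : Measure Ω} {X : Ω → ℝ}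
    (hX : Measurable X) (h : ρ.map X = uniform) (r : ℝ) :
    ∫ ω, Complex.exp ((r * X ω : ℝ) * Complex.I) ∂ρ = charFun uniform r := by
  rw [← h, charFun_apply_real, integral_map hX.aemeasurable (by fun_prop)]
  push_cast
  rfl

lemma charFun_archimedeanMeasure (r a : ℝ) :
    charFun archimedeanMeasure !₂[r * Real.cos a, r * Real.sin a] = charFun uniform r := by
  rw [← integral_exp_of_map_uniform (measurable_direction _ _)
    (archimedeanMeasure_map_direction a)]
  nth_rw 1 [← Measure.map_id (μ := archimedeanMeasure)]
  rw [charFun_map_plane measurable_id]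
  refine integral_congr_ae (ae_of_all _ fun p => ?_)
  simp only [id, Matrix.cons_val_zero, Matrix.cons_val_one,
    Matrix.cons_val_fin_one]
  ring_nf

/-- In the direction `θ` the projection of the normalized vector is `S + D`, the second coordinate;
in the direction `-θ` it is `S - D`, the first. -/
lemma IsPermuton.charFun_normalizedLaw_pos {ν : Measure Plane} (hν : IsPermuton ν)
    (hc : Real.cos (angle ν) ≠ 0) (hs : Real.sin (angle ν) ≠ 0) (r : ℝ) :
    charFun (normalizedLaw ν) !₂[r * Real.cos (angle ν), r * Real.sin (angle ν)] =
      charFun uniform r := by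
  rw [← integral_exp_of_map_uniform (measurable_coord 1) hν.map_snd, normalizedLaw,
    charFun_map_plane (measurable_normalize _)]
  refine integral_congr_ae (ae_of_all _ fun p => ?_)
  simp only [normalize, PiLp.toLp_apply, Matrix.cons_val_zero, Matrix.cons_val_one,
    Matrix.cons_val_fin_one]
  congr 3
  rw [mul_assoc, mul_inv_cancel_left₀ hc, mul_assoc, mul_inv_cancel_left₀ hs, halfSum, halfDiff]
  ring

lemma IsPermuton.charFun_normalizedLaw_neg {ν : Measure Plane} (hν : IsPermuton ν)
    (hc : Real.cos (angle ν) ≠ 0) (hs : Real.sin (angle ν) ≠ 0) (r : ℝ) :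
    charFun (normalizedLaw ν) !₂[r * Real.cos (angle ν), r * Real.sin (-angle ν)] =
      charFun uniform r := by
  rw [← integral_exp_of_map_uniform (measurable_coord 0) hν.map_fst, normalizedLaw,
    charFun_map_plane (measurable_normalize _), Real.sin_neg]
  refine integral_congr_ae (ae_of_all _ fun p => ?_)
  simp only [normalize, PiLp.toLp_apply, Matrix.cons_val_zero, Matrix.cons_val_one,
    Matrix.cons_val_fin_one]
  congr 3
  rw [mul_assoc, mul_inv_cancel_left₀ hc, mul_assoc, neg_mul, mul_inv_cancel_left₀ hs, halfSum,
    halfDiff]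
  ring

/-- Places each frequency off the axes on a line of angle `±πt/2`, where some time `t` in `(0, 1)`
gives information. The radius `r` is signed, so one quarter turn of angles and its reflection reach
all four quadrants. -/
lemma exists_polar {ξ : Plane} (h0 : ξ 0 ≠ 0) (h1 : ξ 1 ≠ 0) : ∃ t : I, 0 < t ∧ t < 1 ∧ ∃ r : ℝ,
    ξ = !₂[r * Real.cos (Real.pi * t / 2), r * Real.sin (Real.pi * t / 2)] ∨
    ξ = !₂[r * Real.cos (Real.pi * t / 2), r * Real.sin (-(Real.pi * t / 2))] := by
  set a := Real.arctan |ξ 1 / ξ 0| with ha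
  have ha0 : 0 < a := Real.arctan_pos.2 (abs_pos.2 (div_ne_zero h1 h0))
  have ha1 : a < Real.pi / 2 := Real.arctan_lt_pi_div_two _
  have hp := Real.pi_pos
  have hc : 0 < Real.cos a := Real.cos_arctan_pos _
  have ht0 : 0 < 2 * a / Real.pi := by positivity
  have ht1 : 2 * a / Real.pi < 1 := by rw [div_lt_one hp]; linarith
  refine ⟨⟨2 * a / Real.pi, ht0.le, ht1.le⟩, ht0, ht1, ξ 0 / Real.cos a, ?_⟩
  have e : Real.pi * (2 * a / Real.pi) / 2 = a := by field_simp
  simp only [e, Real.sin_neg]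
  have htan : Real.sin a = |ξ 1 / ξ 0| * Real.cos a := by
    rw [← Real.tan_arctan |ξ 1 / ξ 0|, ← ha, Real.tan_mul_cos hc.ne']
  rw [htan]
  rcases abs_choice (ξ 1 / ξ 0) with h | h
  · left
    rw [h]
    ext i
    fin_cases i
    · simp [hc.ne']
    · simp; field_simp
  · right
    rw [h]
    ext i
    fin_cases i
    · simp [hc.ne']
    · simp; field_simp

lemma dense_coords_ne_zero : Dense {ξ : Plane | ξ 0 ≠ 0 ∧ ξ 1 ≠ 0} := by
  intro ξ
  have hlim : Tendsto (fun ε : ℝ => ξ + ε • (!₂[1, 1] : Plane)) (𝓝[≠] 0) (𝓝 ξ) := by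
    have : Continuous fun ε : ℝ => ξ + ε • (!₂[1, 1] : Plane) := by fun_prop
    simpa using (this.tendsto 0).mono_left nhdsWithin_le_nhds
  refine mem_closure_of_tendsto hlim ?_
  have h : ∀ x : ℝ, ∀ᶠ ε : ℝ in 𝓝[≠] 0, x + ε ≠ 0 := fun x => by
    have : ∀ᶠ ε : ℝ in 𝓝[≠] 0, ε ∈ ({-x} : Set ℝ)ᶜ :=
      nhdsNE_le_cofinite 0 (Set.finite_singleton (-x)).compl_mem_cofinite
    filter_upwards [this] with ε hε h
    exact hε (by rw [Set.mem_singleton_iff]; linarith)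
  filter_upwards [h (ξ 0), h (ξ 1)] with ε h0 h1
  simpa using And.intro h0 h1

lemma eq_archimedeanPath_of_energy_le (hμ : IsPermutonPath μ) (h0 : μ 0 = idPermuton)
    (h1 : μ 1 = revPermuton) (hE : energy wasserstein μ ≤ ENNReal.ofReal (Real.pi ^ 2 / 6))
    (t : I) : μ t = archimedeanPath t := by
  rcases eq_or_lt_of_le t.2.1 with h | ht
  · rw [show t = 0 from Subtype.ext h.symm, h0, archimedeanPath_zero]
  rcases eq_or_lt_of_le t.2.2 with h | ht1
  · rw [show t = 1 from Subtype.ext h, h1, archimedeanPath_one]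
  have hne : ∀ {s : I}, 0 < s → s < 1 →
      Real.cos (angle (μ s)) ≠ 0 ∧ Real.sin (angle (μ s)) ≠ 0 := by
    intro s hs hs1
    have hs' : (0 : ℝ) < s := hs
    have hs1' : (s : ℝ) < 1 := hs1
    rw [angle_eq_of_energy_le hμ h0 h1 hE hs hs1]
    exact ⟨(Real.cos_pos_of_mem_Ioo ⟨by nlinarith [Real.pi_pos], by nlinarith [Real.pi_pos]⟩).ne',
      (Real.sin_pos_of_pos_of_lt_pi (by nlinarith [Real.pi_pos]) (by nlinarith [Real.pi_pos])).ne'⟩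
  have hprob : IsProbabilityMeasure (μ t) := (hμ.isPermuton t).isProbabilityMeasure
  have hprob' : IsProbabilityMeasure (normalizedLaw (μ t)) :=
    Measure.isProbabilityMeasure_map (measurable_normalize _).aemeasurable
  have hN : normalizedLaw (μ t) = archimedeanMeasure := by
    -- The axes correspond to the excluded times `0` and `1`; continuity of characteristic functions
    -- covers them.
    refine Measure.ext_of_charFun (Continuous.ext_on dense_coords_ne_zero continuous_charFun
      continuous_charFun fun ξ hξ => ?_)
    obtain ⟨s, hs, hs1, r, h⟩ := exists_polar hξ.1 hξ.2
    -- The time is moved from the given `t` to the `s` adapted to the direction of the frequency.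
    rw [charFun_normalizedLaw_path_eq hμ h0 h1 hE (s := t) (t := s) ht ht1 hs hs1]
    obtain ⟨hc, hsn⟩ := hne hs hs1
    have hp := (hμ.isPermuton s).charFun_normalizedLaw_pos hc hsn r
    have hn := (hμ.isPermuton s).charFun_normalizedLaw_neg hc hsn r
    rw [angle_eq_of_energy_le hμ h0 h1 hE hs hs1] at hp hn
    rcases h with rfl | rfl
    · rw [hp, charFun_archimedeanMeasure]
    · rw [hn, ← Real.cos_neg, charFun_archimedeanMeasure]
  obtain ⟨hc, hsn⟩ := hne (s := t) ht ht1
  rw [archimedeanPath_eq_map_symmetricPair, ← hN, normalizedLaw,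
    ← angle_eq_of_energy_le hμ h0 h1 hE ht ht1,
    Measure.map_map (measurable_symmetricPair _) (measurable_normalize _)]
  have : symmetricPair (angle (μ t)) ∘ normalize (angle (μ t)) = id :=
    funext fun p => symmetricPair_normalize hc hsn p
  rw [this, Measure.map_id]

end Rigidity

end PermutonPaths

theorem theorem4 :
    (PermutonPaths.IsPermutonPath PermutonPaths.archimedeanPath ∧
      PermutonPaths.archimedeanPath 0 = PermutonPaths.idPermuton ∧
      PermutonPaths.archimedeanPath 1 = PermutonPaths.revPermuton) ∧
    PermutonPaths.energy PermutonPaths.wasserstein PermutonPaths.archimedeanPath =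
      ENNReal.ofReal (Real.pi ^ 2 / 6) ∧
    ∀ μ : I → Measure PermutonPaths.Plane, PermutonPaths.IsPermutonPath μ →
      μ 0 = PermutonPaths.idPermuton → μ 1 = PermutonPaths.revPermuton →
      ENNReal.ofReal (Real.pi ^ 2 / 6) ≤ PermutonPaths.energy PermutonPaths.wasserstein μ ∧
      (PermutonPaths.energy PermutonPaths.wasserstein μ = ENNReal.ofReal (Real.pi ^ 2 / 6) →
        ∀ t, μ t = PermutonPaths.archimedeanPath t) := by
  open PermutonPaths in
  exact ⟨⟨isPermutonPath_archimedeanPath, archimedeanPath_zero, archimedeanPath_one⟩,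
    le_antisymm energy_archimedeanPath_le
      (le_energy isPermutonPath_archimedeanPath archimedeanPath_zero archimedeanPath_one),
    fun μ hμ h0 h1 => ⟨le_energy hμ h0 h1, fun hE => eq_archimedeanPath_of_energy_le hμ h0 h1 hE.le⟩⟩
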